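/- Let $\mathbb{k}$ be a field of characteristic zero, let $n \ge 2$, let $V$ be a $\mathbb{k}$-vector space with basis $x_1,\dots,x_n$, and write $\mathbf{x}=(x_1,\dots,x_n)$. Let $Q=(q_{ij})$ be an invertible $n\times n$ matrix over $\mathbb{k}$, let $\mathbf{s}=(s_1,\dots,s_n)\in\mathbb{k}^n$ and $k\in\mathbb{k}$. Put $$f=\mathbf{x}Q\mathbf{x}^t=\sum_{i,j}q_{ij}\,x_i\otimes x_j\in V\otimes V,\qquad v=\mathbf{x}\mathbf{s}^t=\sum_i s_i x_i\in V,$$ and let $U=T(V)/(f-v-k)$, the quotient of the tensor algebra by the two-sided ideal generated by $f-v-k$ (a deformation of $A=T(V)/(f)$). Write $U^e=U\otimes U^{op}$, and for an algebra automorphism $\xi$ of $U$ let ${}_1U_\xi$ be the $U$-bimodule $U$ with regular left action and right action twisted by $\xi$, i.e. $a\cdot m\cdot b=a\,m\,\xi(b)$. Then $$\operatorname{Ext}^i_{U^e}(U,U\otimes U)=0\quad\text{for all } i\neq 2,$$ and there is an algebra automorphism $\xi$ of $U$ with $$\xi(\mathbf{x})=-\mathbf{x}\,Q^tQ^{-1}+\mathbf{s}\,Q^{-1},\qquad\text{i.e.}\qquad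 \xi(x_j)=-\sum_{i}(Q^tQ^{-1})_{ij}\,x_i+(\mathbf{s}Q^{-1})_j\quad(1\le j\le n),$$ such that $$\operatorname{Ext}^2_{U^e}(U,U\otimes U)\cong{}_1U_\xi\quad\text{as } U\text{-bimodules}.$$ Here $\operatorname{Ext}_{U^e}$ is taken with respect to the outer bimodule structure $a(x\otimes y)b=ax\otimes yb$ of $U\otimes U$, and the bimodule structure on $\operatorname{Ext}^i_{U^e}(U,U\otimes U)$ is induced by the inner one, $a\cdot(x\otimes y)\cdot b=xb\otimes ay$. -/

import Mathlib

open scoped TensorProduct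
open MulOpposite

universe u v

noncomputable section

namespace NakayamaDim2

open CategoryTheory CategoryTheory.Abelian in
/-- If a ring `S` acts on an `R`-module `Y` by `R`-linear maps, then it acts on `Ext^i_R(X, Y)`
by functoriality in `Y`. -/
abbrev extModule {R S : Type v} [Ring R] [Ring S] (X : ModuleCat.{v} R) {Y : Type v}
    [AddCommGroup Y] [Module R Y] (ρ : S →+* Module.End R Y) (i : ℕ) :
    Module S (Ext X (ModuleCat.of R Y) i) where
  smul z e := e.comp (Ext.mk₀ (ModuleCat.ofHom (ρ z))) (add_zero i)
  one_smul e := by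
    change e.comp (Ext.mk₀ (ModuleCat.ofHom (ρ 1))) (add_zero i) = e
    rw [map_one]
    exact e.comp_mk₀_id
  mul_smul z w e := by
    change e.comp (Ext.mk₀ (ModuleCat.ofHom (ρ (z * w)))) (add_zero i) =
      (e.comp (Ext.mk₀ (ModuleCat.ofHom (ρ w))) (add_zero i)).comp
        (Ext.mk₀ (ModuleCat.ofHom (ρ z))) (add_zero i)
    rw [Ext.comp_assoc_of_third_deg_zero, Ext.mk₀_comp_mk₀, map_mul]
    rfl
  smul_zero z := Ext.zero_comp _ _ _ _ _
  smul_add z e₁ e₂ := Ext.add_comp _ _ _ _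
  add_smul z w e := by
    change e.comp (Ext.mk₀ (ModuleCat.ofHom (ρ (z + w)))) (add_zero i) =
      e.comp (Ext.mk₀ (ModuleCat.ofHom (ρ z))) (add_zero i) +
      e.comp (Ext.mk₀ (ModuleCat.ofHom (ρ w))) (add_zero i)
    rw [map_add, ← Ext.comp_add, ← Ext.mk₀_add]
    rfl
  zero_smul e := by
    change e.comp (Ext.mk₀ (ModuleCat.ofHom (ρ 0))) (add_zero i) = 0
    rw [map_zero, show ModuleCat.ofHom (0 : Y →ₗ[R] Y) = 0 from rfl, Ext.mk₀_zero, Ext.comp_zero]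

section Bimodules

variable (K : Type u) [Field K] (A : Type v) [Ring A] [Algebra K A]

/-- The enveloping algebra `Aᵉ = A ⊗ Aᵒᵖ`. A left `Aᵉ`-module is the same thing as an `A`-bimodule
on which `K` acts centrally: `(a ⊗ op b) • m = a m b`. -/
abbrev Env : Type v := A ⊗[K] Aᵐᵒᵖ

/-- `A` as a bimodule over itself. -/
def Regular (_K : Type u) (A : Type v) : Type v := A

instance : AddCommGroup (Regular K A) := inferInstanceAs (AddCommGroup A)
instance : Module K (Regular K A) := inferInstanceAs (Module K A)

/-- The bimodule structure `(a ⊗ op b) • m = a m b` of `A`. -/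
instance : Module (Env K A) (Regular K A) :=
  Module.compHom (Regular K A)
    (show Env K A →+* Module.End K (Regular K A) from (AlgHom.mulLeftRight K A).toRingHom)

theorem regular_smul (a b m : A) :
    (show A from (a ⊗ₜ[K] op b : Env K A) • (show Regular K A from m)) = a * m * b :=
  AlgHom.mulLeftRight_apply K A a (op b) m

variable {K A} in
/-- The underlying space of the twisted bimodule `₁A_ξ`. -/
def Twisted (_ξ : A ≃ₐ[K] A) : Type v := A

section Twisted

variable {K A} (ξ : A ≃ₐ[K] A)

instance : AddCommGroup (Twisted ξ) := inferInstanceAs (AddCommGroup A)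
instance : Module K (Twisted ξ) := inferInstanceAs (Module K A)

/-- The bimodule structure of `₁A_ξ`: regular on the left, twisted by `ξ` on the right,
`(a ⊗ op b) • m = a m ξ(b)`. -/
instance : Module (Env K A) (Twisted ξ) :=
  Module.compHom (Twisted ξ)
    (show Env K A →+* Module.End K (Twisted ξ) from
      ((AlgHom.mulLeftRight K A).comp
        (Algebra.TensorProduct.map (AlgHom.id K A) (AlgHom.op ξ.toAlgHom))).toRingHom)

theorem twisted_smul (a b m : A) :
    (show A from (a ⊗ₜ[K] op b : Env K A) • (show Twisted ξ from m)) = a * m * ξ b :=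
  AlgHom.mulLeftRight_apply K A a (op (ξ b)) m

end Twisted

/-- Left multiplication, `a ↦ (m ↦ a m)`. -/
def leftMul : A →ₐ[K] Module.End K A := Algebra.lsmul K K A

/-- Right multiplication, `op b ↦ (m ↦ m b)`. -/
def rightMul : Aᵐᵒᵖ →ₐ[K] Module.End K A := Algebra.lsmul K K A

/-- The outer bimodule structure of `A ⊗ A`: `a · (x ⊗ y) · b = a x ⊗ y b`. -/
def outer : Env K A →ₐ[K] Module.End K (A ⊗[K] A) :=
  Module.endTensorEndAlgHom.comp (Algebra.TensorProduct.map (leftMul K A) (rightMul K A))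

/-- The inner bimodule structure of `A ⊗ A`: `a · (x ⊗ y) · b = x b ⊗ a y`. -/
def inner : Env K A →ₐ[K] Module.End K (A ⊗[K] A) :=
  (Module.endTensorEndAlgHom.comp
    (Algebra.TensorProduct.map (rightMul K A) (leftMul K A))).comp
      (Algebra.TensorProduct.comm K A Aᵐᵒᵖ).toAlgHom

theorem outer_tmul (a b x y : A) :
    outer K A (a ⊗ₜ op b) (x ⊗ₜ y) = (a * x) ⊗ₜ (y * b) := rfl

theorem inner_tmul (a b x y : A) :
    inner K A (a ⊗ₜ op b) (x ⊗ₜ y) = (x * b) ⊗ₜ (a * y) := rfl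

theorem inner_outer_comm (z w : Env K A) (t : A ⊗[K] A) :
    inner K A z (outer K A w t) = outer K A w (inner K A z t) := by
  induction z using TensorProduct.induction_on with
  | zero => simp
  | add z₁ z₂ h₁ h₂ => simp only [map_add, LinearMap.add_apply, h₁, h₂]
  | tmul a b =>
    induction w using TensorProduct.induction_on with
    | zero => simp
    | add w₁ w₂ h₁ h₂ => simp only [map_add, LinearMap.add_apply, h₁, h₂]
    | tmul c d =>
      induction t using TensorProduct.induction_on with
      | zero => simp
      | add t₁ t₂ h₁ h₂ => simp only [map_add, h₁, h₂]
      | tmul x y =>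
        induction b using MulOpposite.rec' with
        | _ b =>
          induction d using MulOpposite.rec' with
          | _ d => simp only [outer_tmul, inner_tmul, mul_assoc]

/-- `A ⊗ A`, as an `Aᵉ`-module through the outer bimodule structure. -/
def TensorSquare : Type v := A ⊗[K] A

instance : AddCommGroup (TensorSquare K A) := inferInstanceAs (AddCommGroup (A ⊗[K] A))
instance : Module K (TensorSquare K A) := inferInstanceAs (Module K (A ⊗[K] A))

instance : Module (Env K A) (TensorSquare K A) :=
  Module.compHom (TensorSquare K A)
    (show Env K A →+* Module.End K (TensorSquare K A) from (outer K A).toRingHom)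

/-- The inner structure acts on `A ⊗ A` by endomorphisms of the outer bimodule. -/
def innerEnd : Env K A →+* Module.End (Env K A) (TensorSquare K A) where
  toFun z :=
    { toFun := fun t => inner K A z t
      map_add' := fun t₁ t₂ => map_add (inner K A z) t₁ t₂
      map_smul' := fun w t => inner_outer_comm K A z w t }
  map_one' := by
    ext t
    exact LinearMap.congr_fun (map_one (inner K A)) t
  map_mul' z w := by
    ext t
    exact LinearMap.congr_fun (map_mul (inner K A) z w) t
  map_zero' := by
    ext t
    exact LinearMap.congr_fun (map_zero (inner K A)) t
  map_add' z w := by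
    ext t
    exact LinearMap.congr_fun (map_add (inner K A) z w) t

open CategoryTheory CategoryTheory.Abelian in
/-- `Ext^i_{Aᵉ}(A, A ⊗ A)`, where `A ⊗ A` carries the outer structure. -/
def ExtTensorSquare (i : ℕ) : Type v :=
  Ext (ModuleCat.of (Env K A) (Regular K A)) (ModuleCat.of (Env K A) (TensorSquare K A)) i

instance (i : ℕ) : AddCommGroup (ExtTensorSquare K A i) :=
  inferInstanceAs (AddCommGroup (CategoryTheory.Abelian.Ext _ _ i))

/-- The `A`-bimodule structure of `Ext^i_{Aᵉ}(A, A ⊗ A)` induced, by functoriality in the second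
argument, by the inner bimodule structure of `A ⊗ A`. -/
instance (i : ℕ) : Module (Env K A) (ExtTensorSquare K A i) :=
  extModule _ (innerEnd K A) i

end Bimodules

section Algebras

variable {K : Type u} [Field K] {V : Type v} [AddCommGroup V] [Module K V]

/-- `T(V)/(r)`, the quotient of the tensor algebra by the two-sided ideal generated by `r`. -/
abbrev TensorAlgebraMod (r : TensorAlgebra K V) : Type (max u v) :=
  RingQuot (fun a b : TensorAlgebra K V => a = r ∧ b = 0)

/-- The element `f = 𝐱 Q 𝐱ᵗ = ∑ q_ij x_i ⊗ x_j` of `T(V)`. -/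
def quadraticElement {n : ℕ} (x : Fin n → V) (Q : Matrix (Fin n) (Fin n) K) : TensorAlgebra K V :=
  ∑ i, ∑ j, Q i j • (TensorAlgebra.ι K (x i) * TensorAlgebra.ι K (x j))

/-- The element `f - v - κ` of `T(V)`, with `f = 𝐱 Q 𝐱ᵗ` and `v = 𝐱 𝐬ᵗ`. -/
def relator {n : ℕ} (x : Fin n → V) (Q : Matrix (Fin n) (Fin n) K) (s : Fin n → K) (κ : K) :
    TensorAlgebra K V :=
  quadraticElement x Q - TensorAlgebra.ι K (∑ i, s i • x i) - algebraMap K (TensorAlgebra K V) κ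

/-- The algebra `U = T(V)/(f - v - κ)`. -/
abbrev Deformation {n : ℕ} (x : Fin n → V) (Q : Matrix (Fin n) (Fin n) K) (s : Fin n → K)
    (κ : K) : Type (max u v) :=
  TensorAlgebraMod (relator x Q s κ)

/-- The image of `x_j` in `U = T(V)/(f - v - κ)`. -/
def gen {n : ℕ} (x : Fin n → V) (Q : Matrix (Fin n) (Fin n) K) (s : Fin n → K) (κ : K)
    (j : Fin n) : Deformation x Q s κ :=
  RingQuot.mkAlgHom K _ (TensorAlgebra.ι K (x j))

end Algebras

end NakayamaDim2

end

/-! Write Y_j = ∑ q_ij x_i, Z_j = ∑ q_ji x_i and δ_j = x_j ⊗ 1 - 1 ⊗ x_j. In U the relation reads ∑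
Y_j x_j = ∑ x_j Z_j = v + k, and its partial derivatives in Uᵉ are r_j = Y_j ⊗ 1 + 1 ⊗ (Z_j - s_j).
The proof rests on the free resolution 0 → Uᵉ → (Uᵉ)ⁿ → Uᵉ → U → 0 with maps t ↦ (t r_j) and (t_i) ↦
∑ t_i δ_i.

Exactness on the right says that the x_i generate U. Exactness in the middle (`exists_relMap_eq`)
says that bimodule derivations of U are free on the values at the x_i up to the single condition ∑
r_j dx_j = 0; it follows from the universal property of U. Injectivity on the left
(`eq_zero_of_mul_relDeriv`) is where n ≥ 2 and the invertibility of Q enter: right multiplication by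
a nonzero linear form strictly raises the degree in U. This comes from a PBW-type statement, that
the degree filtration of the ideal of relations is strict (`relDegLE_succ_inf_degLT_le`).

The resolution is self-dual. The automorphism ξ is characterized by ξ(Y_j) = s_j - Z_j, so the
anti-automorphism a ⊗ b ↦ b ⊗ ξ(a) of Uᵉ sends r_j to Z_j ⊗ 1 - 1 ⊗ Z_j and Y_j ⊗ 1 - 1 ⊗ Y_j to
-r_j. Up to the invertible Q, it carries the complex Hom(-, U ⊗ U) back to the resolution. Hence Ext
vanishes outside degree 2, and Ext² is the cokernel of multiplication followed by this flip, that
is, U ⊗ U modulo the kernel of x ⊗ y ↦ y ξ(x), which is ₁U_ξ. -/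

noncomputable section

namespace NakayamaDim2

/-! ### Induction along generators of an algebra -/

section Generation

variable {K : Type*} [CommSemiring K] {B : Type*} [Semiring B] [Algebra K B] {I : Type*} {g : I → B}

/-- Induction on an element of an algebra, adding one generator at a time on the left. -/
theorem left_induction (hg : Algebra.adjoin K (Set.range g) = ⊤) (S : Submodule K B)
    (h1 : 1 ∈ S) (hS : ∀ i, ∀ b ∈ S, g i * b ∈ S) (b : B) : b ∈ S := by
  suffices h : ∀ a ∈ Algebra.adjoin K (Set.range g), ∀ c ∈ S, a * c ∈ S by
    simpa using h b (hg ▸ Algebra.mem_top) 1 h1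
  intro a ha
  induction ha using Algebra.adjoin_induction with
  | mem a ha => obtain ⟨i, rfl⟩ := ha; exact hS i
  | algebraMap k => intro c hc; rw [← Algebra.smul_def]; exact S.smul_mem k hc
  | add a b _ _ ha hb => intro c hc; rw [add_mul]; exact S.add_mem (ha c hc) (hb c hc)
  | mul a b _ _ ha hb => intro c hc; rw [mul_assoc]; exact ha _ (hb c hc)

/-- Induction on an element of an algebra, adding one generator at a time on the right. -/
theorem right_induction (hg : Algebra.adjoin K (Set.range g) = ⊤) (S : Submodule K B)
    (h1 : 1 ∈ S) (hS : ∀ i, ∀ b ∈ S, b * g i ∈ S) (b : B) : b ∈ S := by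
  suffices h : ∀ a ∈ Algebra.adjoin K (Set.range g), ∀ c ∈ S, c * a ∈ S by
    simpa using h b (hg ▸ Algebra.mem_top) 1 h1
  intro a ha
  induction ha using Algebra.adjoin_induction with
  | mem a ha => obtain ⟨i, rfl⟩ := ha; exact hS i
  | algebraMap k =>
    intro c hc
    rw [← Algebra.commutes, ← Algebra.smul_def]
    exact S.smul_mem k hc
  | add a b _ _ ha hb => intro c hc; rw [mul_add]; exact S.add_mem (ha c hc) (hb c hc)
  | mul a b _ _ ha hb => intro c hc; rw [← mul_assoc]; exact hb _ (ha c hc)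

end Generation

/-! ### Right quotients and the degree filtration of the tensor algebra -/

section TensorAlgebra

variable {K : Type u} [Field K] {V : Type v} [AddCommGroup V] [Module K V] {n : ℕ}
  (x : Module.Basis (Fin n) K V)

/-- The generator `x_i` of the tensor algebra. -/
abbrev tgen (i : Fin n) : TensorAlgebra K V := TensorAlgebra.ι K (x i)

theorem adjoin_range_tgen : Algebra.adjoin K (Set.range (tgen x)) = ⊤ := by
  rw [eq_top_iff, ← TensorAlgebra.adjoin_range_ι, Algebra.adjoin_le_iff]
  rintro _ ⟨w, rfl⟩
  rw [← x.sum_repr w, map_sum]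
  refine Subalgebra.sum_mem _ fun i _ => ?_
  rw [map_smul]
  exact Subalgebra.smul_mem _ (Algebra.subset_adjoin (Set.mem_range_self i)) _

/-- The representation of `T(V)` that computes the right quotients by the generators. -/
def divHom : TensorAlgebra K V →ₐ[K] Module.End K ((Fin n → TensorAlgebra K V) × K) :=
  -- The pair (p, c) stands for ∑ p_i x_i + c. Left multiplication by w turns it into ∑ (w p_i + c
  -- w_i) x_i, whose constant term is zero.
  TensorAlgebra.lift K (LinearMap.mk₂ K
    (fun w p => (fun i => TensorAlgebra.ι K w * p.1 i + algebraMap K _ (x.repr w i * p.2), 0))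
    (fun w w' p => by
      ext i
      · simp only [map_add, add_mul, Finsupp.add_apply, Prod.fst_add, Pi.add_apply]
        abel
      · simp)
    (fun c w p => by
      ext i
      · simp [Algebra.smul_def, mul_add, mul_assoc]
      · simp)
    (fun w p p' => by
      ext i
      · simp only [mul_add, Prod.fst_add, Prod.snd_add, Pi.add_apply, map_add]
        abel
      · simp)
    (fun c w p => by
      ext i
      · simp only [Prod.smul_fst, Prod.smul_snd, Pi.smul_apply, mul_smul_comm, smul_add,
          Algebra.algebraMap_eq_smul_one, smul_assoc]
      · simp))

theorem divHom_tgen (i : Fin n) (p : (Fin n → TensorAlgebra K V) × K) :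
    divHom x (tgen x i) p =
      (fun j => tgen x i * p.1 j + if i = j then algebraMap K _ p.2 else 0, 0) := by
  rw [divHom, TensorAlgebra.lift_ι_apply]
  ext j
  · simp [Finsupp.single_apply]
  · simp

/-- The right quotient of an element of `T(V)` by `x_i`. -/
def rdiv (i : Fin n) : TensorAlgebra K V →ₗ[K] TensorAlgebra K V :=
  LinearMap.proj i ∘ₗ LinearMap.fst K _ _ ∘ₗ LinearMap.applyₗ (0, 1) ∘ₗ (divHom x).toLinearMap

/-- The constant term of an element of `T(V)`. -/
def constTerm : TensorAlgebra K V →ₗ[K] K :=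
  LinearMap.snd K _ _ ∘ₗ LinearMap.applyₗ (0, 1) ∘ₗ (divHom x).toLinearMap

theorem rdiv_one (i : Fin n) : rdiv x i 1 = 0 := by
  simp [rdiv]

theorem constTerm_one : constTerm x 1 = 1 := by
  simp [constTerm]

theorem rdiv_tgen_mul (i j : Fin n) (a : TensorAlgebra K V) :
    rdiv x j (tgen x i * a) =
      tgen x i * rdiv x j a + if i = j then algebraMap K _ (constTerm x a) else 0 := by
  simp only [rdiv, constTerm, LinearMap.comp_apply, AlgHom.toLinearMap_apply, map_mul,
    LinearMap.applyₗ_apply_apply, Module.End.mul_apply, divHom_tgen]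
  rfl

theorem constTerm_tgen_mul (i : Fin n) (a : TensorAlgebra K V) :
    constTerm x (tgen x i * a) = 0 := by
  simp only [constTerm, LinearMap.comp_apply, AlgHom.toLinearMap_apply, map_mul,
    LinearMap.applyₗ_apply_apply, Module.End.mul_apply, divHom_tgen]
  rfl

/-- This identifies `rdiv` as division on the right, although it is built from left multiplications.
In the induction on a, the correction term of `rdiv_tgen_mul` disappears because b x_i has no
constant term. -/
theorem rdiv_mul_tgen (i j : Fin n) (a : TensorAlgebra K V) :
    rdiv x j (a * tgen x i) = if i = j then a else 0 := by
  have h := left_induction (adjoin_range_tgen x)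
    (LinearMap.ker (rdiv x j ∘ₗ LinearMap.mulRight K (tgen x i) -
      if i = j then LinearMap.id else 0)) ?_ (fun k b hb => ?_) a
  · rw [LinearMap.mem_ker, LinearMap.sub_apply, LinearMap.comp_apply, LinearMap.mulRight_apply,
      sub_eq_zero] at h
    rw [h]
    split_ifs <;> rfl
  · have h := rdiv_tgen_mul x i j 1
    rw [mul_one, rdiv_one, mul_zero, zero_add, constTerm_one, map_one] at h
    rw [LinearMap.mem_ker, LinearMap.sub_apply, LinearMap.comp_apply, LinearMap.mulRight_apply,
      one_mul, h]
    split_ifs <;> simp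
  · rw [LinearMap.mem_ker, LinearMap.sub_apply, LinearMap.comp_apply, LinearMap.mulRight_apply,
      sub_eq_zero] at hb ⊢
    have hc : constTerm x (b * tgen x i) = 0 := by
      refine left_induction (adjoin_range_tgen x)
        (LinearMap.ker (constTerm x ∘ₗ LinearMap.mulRight K (tgen x i))) ?_ (fun k b _ => ?_) b
      · have := constTerm_tgen_mul x i 1
        rw [mul_one] at this
        simpa using this
      · rw [LinearMap.mem_ker, LinearMap.comp_apply, LinearMap.mulRight_apply, mul_assoc,
          constTerm_tgen_mul]
    rw [mul_assoc, rdiv_tgen_mul, hb, hc]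
    split_ifs <;> simp

theorem rdiv_sum_mul_tgen (u : Fin n → TensorAlgebra K V) (j : Fin n) :
    rdiv x j (∑ i, u i * tgen x i) = u j := by
  simp [map_sum, rdiv_mul_tgen]

/-- The elements of `T(V)` of degree less than `d`. -/
def degLT : ℕ → Submodule K (TensorAlgebra K V)
  | 0 => ⊥
  -- The constant term is left unconstrained, so the scalars already lie in step 1.
  | d + 1 => ⨅ i, (degLT d).comap (rdiv x i)

theorem mem_degLT_succ {d : ℕ} {a : TensorAlgebra K V} :
    a ∈ degLT x (d + 1) ↔ ∀ i, rdiv x i a ∈ degLT x d := by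
  simp [degLT]

theorem degLT_le_succ (d : ℕ) : degLT x d ≤ degLT x (d + 1) := by
  induction d with
  | zero => exact bot_le
  | succ d ih =>
    intro a ha
    rw [mem_degLT_succ] at ha ⊢
    exact fun i => ih (ha i)

theorem degLT_mono : Monotone (degLT x) := monotone_nat_of_le_succ (degLT_le_succ x)

theorem rdiv_mem_degLT {d : ℕ} {a : TensorAlgebra K V} (ha : a ∈ degLT x d) (i : Fin n) :
    rdiv x i a ∈ degLT x d :=
  mem_degLT_succ x |>.1 (degLT_le_succ x d ha) i

theorem sum_mul_tgen_mem_degLT {d : ℕ} {u : Fin n → TensorAlgebra K V} :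
    ∑ i, u i * tgen x i ∈ degLT x (d + 1) ↔ ∀ i, u i ∈ degLT x d := by
  simp only [mem_degLT_succ, rdiv_sum_mul_tgen]

theorem mul_tgen_mem_degLT {d : ℕ} {a : TensorAlgebra K V} (ha : a ∈ degLT x d) (i : Fin n) :
    a * tgen x i ∈ degLT x (d + 1) := by
  rw [mem_degLT_succ]
  intro j
  rw [rdiv_mul_tgen]
  split_ifs
  exacts [ha, zero_mem _]

theorem one_mem_degLT (d : ℕ) : 1 ∈ degLT x (d + 1) := by
  rw [mem_degLT_succ]
  intro i
  rw [rdiv_one]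
  exact zero_mem _

theorem tgen_mul_mem_degLT {d : ℕ} {a : TensorAlgebra K V} (ha : a ∈ degLT x d) (i : Fin n) :
    tgen x i * a ∈ degLT x (d + 1) := by
  induction d generalizing a with
  | zero =>
    obtain rfl : a = 0 := ha
    rw [mul_zero]
    exact zero_mem _
  | succ d ih =>
    rw [mem_degLT_succ] at ha ⊢
    intro j
    rw [rdiv_tgen_mul]
    refine add_mem (ih (ha j)) ?_
    split_ifs
    · rw [Algebra.algebraMap_eq_smul_one]
      exact Submodule.smul_mem _ _ (one_mem_degLT x d)
    · exact zero_mem _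

theorem exists_mem_degLT (a : TensorAlgebra K V) : ∃ d, a ∈ degLT x d := by
  have h := left_induction (adjoin_range_tgen x) (⨆ d, degLT x d) ?_ ?_ a
  · exact (Submodule.mem_iSup_of_directed _ (degLT_mono x).directed_le).1 h
  · exact Submodule.mem_iSup_of_mem 1 (one_mem_degLT x 0)
  · intro i b hb
    rw [Submodule.mem_iSup_of_directed _ (degLT_mono x).directed_le] at hb
    obtain ⟨d, hd⟩ := hb
    exact Submodule.mem_iSup_of_mem (d + 1) (tgen_mul_mem_degLT x hd i)

end TensorAlgebra

/-! ### The filtered ideal of relations -/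

section Relator

variable {K : Type u} [Field K] {V : Type v} [AddCommGroup V] [Module K V] {n : ℕ}
  (x : Module.Basis (Fin n) K V) (Q : Matrix (Fin n) (Fin n) K) (s : Fin n → K) (κ : K)

theorem relator_eq : relator x Q s κ =
    ∑ j, Fintype.linearCombination K (tgen x) (Q.col j) * tgen x j -
      ∑ j, s j • tgen x j - algebraMap K _ κ := by
  simp only [relator, quadraticElement, map_sum, map_smul, Fintype.linearCombination_apply,
    Finset.sum_mul, smul_mul_assoc]
  rw [Finset.sum_comm]
  rfl

theorem mul_relator (b : TensorAlgebra K V) : b * relator x Q s κ =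
    ∑ j, (b * Fintype.linearCombination K (tgen x) (Q.col j) - s j • b) * tgen x j - κ • b := by
  simp only [relator_eq, mul_sub, Finset.mul_sum, sub_mul, Finset.sum_sub_distrib, mul_assoc,
    smul_mul_assoc, mul_smul_comm, Algebra.algebraMap_eq_smul_one, mul_one]

/-- The leading part of the quotient is b Y_i; the other terms have degree at most that of b. -/
theorem rdiv_mul_relator (b : TensorAlgebra K V) (i : Fin n) : rdiv x i (b * relator x Q s κ) =
    b * Fintype.linearCombination K (tgen x) (Q.col i) - s i • b - κ • rdiv x i b := by
  rw [mul_relator, map_sub, rdiv_sum_mul_tgen, map_smul]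

theorem mul_linearCombination_mem_degLT {d : ℕ} {a : TensorAlgebra K V} (ha : a ∈ degLT x d)
    (c : Fin n → K) : a * Fintype.linearCombination K (tgen x) c ∈ degLT x (d + 1) := by
  rw [Fintype.linearCombination_apply, Finset.mul_sum]
  refine Submodule.sum_mem _ fun i _ => ?_
  rw [mul_smul_comm]
  exact Submodule.smul_mem _ _ (mul_tgen_mem_degLT x ha i)

/-- The elements `∑ p r q` of the ideal generated by the relator `r`, where the products `p r q`
have degree at most `d` (the degree of `r` being `2`). -/
def relDegLE : ℕ → Submodule K (TensorAlgebra K V)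
  | 0 => ⊥
  -- Here b has degree at most d - 1, so b r has degree at most d + 1.
  | d + 1 => (degLT x d).map (LinearMap.mulRight K (relator x Q s κ)) ⊔
      (Submodule.pi Set.univ fun _ => relDegLE d).map
        (∑ i, LinearMap.mulRight K (tgen x i) ∘ₗ LinearMap.proj i)

variable {x Q s κ}

theorem mem_relDegLE_succ {d : ℕ} {w : TensorAlgebra K V} : w ∈ relDegLE x Q s κ (d + 1) ↔
    ∃ b ∈ degLT x d, ∃ u : Fin n → TensorAlgebra K V, (∀ i, u i ∈ relDegLE x Q s κ d) ∧
      b * relator x Q s κ + ∑ i, u i * tgen x i = w := by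
  simp only [relDegLE, Submodule.mem_sup, Submodule.mem_map, Submodule.mem_pi, Set.mem_univ,
    forall_true_left, LinearMap.mulRight_apply, LinearMap.sum_apply, LinearMap.comp_apply,
    LinearMap.proj_apply]
  constructor
  · rintro ⟨_, ⟨b, hb, rfl⟩, _, ⟨u, hu, rfl⟩, rfl⟩
    exact ⟨b, hb, u, hu, rfl⟩
  · rintro ⟨b, hb, u, hu, rfl⟩
    exact ⟨_, ⟨b, hb, rfl⟩, _, ⟨u, hu, rfl⟩, rfl⟩

theorem mul_relator_mem_relDegLE {d : ℕ} {b : TensorAlgebra K V} (hb : b ∈ degLT x d) :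
    b * relator x Q s κ ∈ relDegLE x Q s κ (d + 1) :=
  mem_relDegLE_succ.2 ⟨b, hb, 0, fun _ => zero_mem _, by simp⟩

theorem sum_mul_tgen_mem_relDegLE {d : ℕ} {u : Fin n → TensorAlgebra K V}
    (hu : ∀ i, u i ∈ relDegLE x Q s κ d) : ∑ i, u i * tgen x i ∈ relDegLE x Q s κ (d + 1) :=
  mem_relDegLE_succ.2 ⟨0, zero_mem _, u, hu, by simp⟩

theorem mul_linearCombination_mem_relDegLE {d : ℕ} {u : TensorAlgebra K V}
    (hu : u ∈ relDegLE x Q s κ d) (c : Fin n → K) :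
    u * Fintype.linearCombination K (tgen x) c ∈ relDegLE x Q s κ (d + 1) := by
  have := sum_mul_tgen_mem_relDegLE (x := x) (u := fun i => c i • u)
    fun i => Submodule.smul_mem _ (c i) hu
  simpa [Fintype.linearCombination_apply, Finset.mul_sum] using this

theorem mul_tgen_mem_relDegLE {d : ℕ} {u : TensorAlgebra K V}
    (hu : u ∈ relDegLE x Q s κ d) (i : Fin n) :
    u * tgen x i ∈ relDegLE x Q s κ (d + 1) := by
  simpa using mul_linearCombination_mem_relDegLE hu (Pi.single i 1)

theorem relDegLE_le_succ (d : ℕ) : relDegLE x Q s κ d ≤ relDegLE x Q s κ (d + 1) := by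
  induction d with
  | zero => exact bot_le
  | succ d ih =>
    intro w hw
    obtain ⟨b, hb, u, hu, rfl⟩ := mem_relDegLE_succ.1 hw
    exact mem_relDegLE_succ.2 ⟨b, degLT_le_succ x d hb, u, fun i => ih (hu i), rfl⟩

theorem relDegLE_mono : Monotone (relDegLE x Q s κ) := monotone_nat_of_le_succ relDegLE_le_succ

theorem relDegLE_le_degLT (d : ℕ) : relDegLE x Q s κ d ≤ degLT x (d + 1) := by
  induction d with
  | zero => exact bot_le
  | succ d ih =>
    intro w hw
    obtain ⟨b, hb, u, hu, rfl⟩ := mem_relDegLE_succ.1 hw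
    refine add_mem ?_ ((sum_mul_tgen_mem_degLT x).2 fun i => ih (hu i))
    rw [mem_degLT_succ]
    intro i
    rw [rdiv_mul_relator]
    have hb' := degLT_le_succ x d hb
    exact sub_mem (sub_mem (mul_linearCombination_mem_degLT x hb _) (Submodule.smul_mem _ _ hb'))
      (Submodule.smul_mem _ _ (rdiv_mem_degLT x hb' i))

theorem tgen_mul_mem_relDegLE {d : ℕ} {u : TensorAlgebra K V} (hu : u ∈ relDegLE x Q s κ d)
    (i : Fin n) : tgen x i * u ∈ relDegLE x Q s κ (d + 1) := by
  induction d generalizing u with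
  | zero =>
    obtain rfl : u = 0 := hu
    rw [mul_zero]
    exact zero_mem _
  | succ d ih =>
    obtain ⟨b, hb, w, hw, rfl⟩ := mem_relDegLE_succ.1 hu
    refine mem_relDegLE_succ.2 ⟨_, tgen_mul_mem_degLT x hb i, _, fun j => ih (hw j), ?_⟩
    simp only [mul_add, mul_assoc, Finset.mul_sum]

/-- Modulo lower degrees, right multiplication by a nonzero linear form is injective. -/
theorem mem_of_mul_linearCombination_mem (hn : 2 ≤ n) (hQ : IsUnit Q) {d : ℕ}
    {a : TensorAlgebra K V} {γ : Fin n → K} (hγ : γ ≠ 0)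
    (h : a * Fintype.linearCombination K (tgen x) γ ∈ relDegLE x Q s κ (d + 1) ⊔ degLT x (d + 1)) :
    a ∈ relDegLE x Q s κ d ⊔ degLT x d := by
  induction d generalizing a γ with
  | zero =>
    -- Step 1 of the ideal is zero and step 1 of the degree filtration is the scalars, so a γ is a
    -- scalar; its quotient γ_i a then vanishes.
    obtain ⟨w, hw, c, hc, hwc⟩ := Submodule.mem_sup.1 h
    obtain ⟨b, rfl : b = 0, u, hu, rfl⟩ := mem_relDegLE_succ.1 hw
    obtain ⟨i, hi⟩ := Function.ne_iff.1 hγ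
    have hui : u i = 0 := hu i
    have hci : rdiv x i c = 0 := (mem_degLT_succ x).1 hc i
    have key := congrArg (rdiv x i) hwc
    rw [Fintype.linearCombination_apply, Finset.mul_sum] at key
    simp only [zero_mul, zero_add, map_add, rdiv_sum_mul_tgen, hui, hci, mul_smul_comm,
      ← smul_mul_assoc] at key
    have : a = 0 := (smul_eq_zero.1 key.symm).resolve_left hi
    rw [this]
    exact zero_mem _
  | succ d ih =>
    obtain ⟨w, hw, c, hc, hwc⟩ := Submodule.mem_sup.1 h
    obtain ⟨b, hb, u, hu, rfl⟩ := mem_relDegLE_succ.1 hw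
    -- Comparing right quotients by x_i in a γ = b r + ∑ u_i x_i + c gives γ_i a ≡ b Y_i.
    have key (i : Fin n) : γ i • a - b * Fintype.linearCombination K (tgen x) (Q.col i) ∈
        relDegLE x Q s κ (d + 1) ⊔ degLT x (d + 1) := by
      have key := congrArg (rdiv x i) hwc
      rw [Fintype.linearCombination_apply, Finset.mul_sum] at key
      simp only [map_add, rdiv_sum_mul_tgen, mul_smul_comm, ← smul_mul_assoc,
        rdiv_mul_relator] at key
      rw [← key]
      have : b * Fintype.linearCombination K (tgen x) (Q.col i) - s i • b - κ • rdiv x i b + u i +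
          rdiv x i c - b * Fintype.linearCombination K (tgen x) (Q.col i) =
          u i + (rdiv x i c - s i • b - κ • rdiv x i b) := by abel
      rw [this]
      exact Submodule.add_mem_sup (hu i) (sub_mem (sub_mem ((mem_degLT_succ x).1 hc i)
        (Submodule.smul_mem _ _ hb)) (Submodule.smul_mem _ _ (rdiv_mem_degLT x hb i)))
    -- As n ≥ 2, some nonzero δ is orthogonal to γ. Weighting the congruences by δ eliminates a and
    -- leaves b · (𝐱 Q δ) ≡ 0 with Q δ ≠ 0, to which the induction hypothesis applies.
    obtain ⟨δ, hδ, hδγ⟩ : ∃ δ : Fin n → K, δ ≠ 0 ∧ δ ⬝ᵥ γ = 0 := by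
      have : ¬ Function.Injective (dotProductBilin K K |>.flip γ : (Fin n → K) →ₗ[K] K) := by
        intro hinj
        have := LinearMap.finrank_le_finrank_of_injective hinj
        simp at this
        omega
      rw [← LinearMap.ker_eq_bot, Submodule.eq_bot_iff] at this
      push Not at this
      obtain ⟨δ, h1, h2⟩ := this
      exact ⟨δ, h2, h1⟩
    have hb' : b ∈ relDegLE x Q s κ d ⊔ degLT x d := by
      refine ih (γ := Q.mulVec δ) (fun h0 => hδ ?_) ?_
      · exact (Matrix.mulVec_injective_iff_isUnit.2 hQ) (by rw [h0, Matrix.mulVec_zero])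
      · have := Submodule.sum_mem _ fun i (_ : i ∈ Finset.univ) =>
          Submodule.smul_mem _ (-δ i) (key i)
        convert this using 1
        simp only [smul_sub, neg_smul, Finset.sum_sub_distrib, Finset.sum_neg_distrib, smul_smul,
          ← Finset.sum_smul]
        rw [dotProduct] at hδγ
        simp only [neg_mul, Finset.sum_neg_distrib]
        rw [hδγ, neg_zero, zero_smul, zero_sub, neg_neg, Matrix.mulVec_eq_sum, map_sum,
          Finset.mul_sum]
        refine Finset.sum_congr rfl fun i _ => ?_
        rw [op_smul_eq_smul, map_smul, mul_smul_comm]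
        rfl
    obtain ⟨i, hi⟩ := Function.ne_iff.1 hγ
    -- With b now known to be small, b Y_i is negligible, hence so is γ_i a, for an index with γ_i ≠
    -- 0.
    have hbY : b * Fintype.linearCombination K (tgen x) (Q.col i) ∈
        relDegLE x Q s κ (d + 1) ⊔ degLT x (d + 1) := by
      obtain ⟨b₁, h₁, b₂, h₂, rfl⟩ := Submodule.mem_sup.1 hb'
      rw [add_mul]
      exact Submodule.add_mem_sup (mul_linearCombination_mem_relDegLE h₁ _)
        (mul_linearCombination_mem_degLT x h₂ _)
    have := add_mem (key i) hbY
    rw [sub_add_cancel] at this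
    exact (Submodule.smul_mem_iff _ hi).1 this

/-- The degree filtration of the ideal generated by the relator is strict. -/
theorem relDegLE_succ_inf_degLT_le (hn : 2 ≤ n) (hQ : IsUnit Q) (d : ℕ) {w : TensorAlgebra K V}
    (hw : w ∈ relDegLE x Q s κ (d + 1)) (hw' : w ∈ degLT x (d + 1)) :
    w ∈ relDegLE x Q s κ d := by
  induction d generalizing w with
  | zero =>
    obtain ⟨b, rfl : b = 0, u, hu, rfl⟩ := mem_relDegLE_succ.1 hw
    have : u = 0 := funext hu
    simp [this]
  | succ d ih =>
    obtain ⟨b, hb, u, hu, rfl⟩ := mem_relDegLE_succ.1 hw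
    have hcol : Q.col ⟨0, by omega⟩ ≠ 0 := fun h0 => by
      have h1 := Matrix.mulVec_injective_iff_isUnit.2 hQ
      have := @h1 (Pi.single ⟨0, by omega⟩ 1) 0
        (by rw [Matrix.mulVec_single_one, h0, Matrix.mulVec_zero])
      simpa using congrFun this ⟨0, by omega⟩
    -- The degree bound on w makes b Y_0 + u_0 of lower degree, so the previous cancellation lemma
    -- applies to b.
    have hbd : b ∈ relDegLE x Q s κ d ⊔ degLT x d := by
      refine mem_of_mul_linearCombination_mem hn hQ hcol ?_
      have h := (mem_degLT_succ x).1 hw' ⟨0, by omega⟩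
      rw [map_add, rdiv_sum_mul_tgen, rdiv_mul_relator] at h
      have h2 := sub_mem (Submodule.add_mem_sup (zero_mem _) (add_mem (add_mem h
        (Submodule.smul_mem _ κ (rdiv_mem_degLT x hb ⟨0, by omega⟩)))
        (Submodule.smul_mem _ (s ⟨0, by omega⟩) hb)))
        (Submodule.mem_sup_left (T := degLT x (d + 1)) (hu ⟨0, by omega⟩))
      convert h2 using 1
      abel
    obtain ⟨b₁, h₁, b₂, h₂, rfl⟩ := Submodule.mem_sup.1 hbd
    -- The part b₁ of b lies in the ideal itself, so b₁ r can be expanded as ∑ (b₁ Y_i) x_i plus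
    -- lower terms and absorbed into the u_i. The new u'_i have smaller degree and fall under the
    -- induction hypothesis.
    set u' : Fin n → TensorAlgebra K V := fun i =>
      b₁ * Fintype.linearCombination K (tgen x) (Q.col i) + u i with hu'
    have hu'J (i) : u' i ∈ relDegLE x Q s κ (d + 1) :=
      add_mem (mul_linearCombination_mem_relDegLE h₁ _) (hu i)
    have hrest : b₂ * relator x Q s κ - ∑ i, s i • (b₁ * tgen x i) - κ • b₁ ∈
        relDegLE x Q s κ (d + 1) :=
      sub_mem (sub_mem (mul_relator_mem_relDegLE h₂) (Submodule.sum_mem _ fun i _ =>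
        Submodule.smul_mem _ _ (mul_tgen_mem_relDegLE h₁ i)))
        (Submodule.smul_mem _ _ (relDegLE_le_succ d h₁))
    have heq : (b₁ + b₂) * relator x Q s κ + ∑ i, u i * tgen x i =
        (b₂ * relator x Q s κ - ∑ i, s i • (b₁ * tgen x i) - κ • b₁) + ∑ i, u' i * tgen x i := by
      rw [add_mul, mul_relator x Q s κ b₁]
      simp only [hu', add_mul, sub_mul, Finset.sum_sub_distrib, Finset.sum_add_distrib,
        smul_mul_assoc]
      abel
    rw [heq] at hw' ⊢
    refine add_mem hrest (sum_mul_tgen_mem_relDegLE fun i => ih (hu'J i) ?_)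
    have := sub_mem hw' (relDegLE_le_degLT _ hrest)
    rw [add_sub_cancel_left, sum_mul_tgen_mem_degLT] at this
    exact this i

theorem relDegLE_inf_degLT_le (hn : 2 ≤ n) (hQ : IsUnit Q) (m d : ℕ) {w : TensorAlgebra K V}
    (hw : w ∈ relDegLE x Q s κ m) (hw' : w ∈ degLT x (d + 1)) : w ∈ relDegLE x Q s κ d := by
  induction m with
  | zero => exact relDegLE_mono d.zero_le hw
  | succ m ih =>
    obtain h | h := le_or_gt (m + 1) d
    · exact relDegLE_mono h hw
    · exact ih (relDegLE_succ_inf_degLT_le hn hQ m hw (degLT_mono x h hw'))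

/-- The union N of the filtration is a left ideal containing r T(V). So r acts by zero on T(V)/N,
which becomes a U-module; an element that dies in U kills the class of 1 and lies in N. -/
theorem exists_mem_relDegLE {a : TensorAlgebra K V}
    (ha : RingQuot.mkAlgHom K (fun a b => a = relator x Q s κ ∧ b = 0) a = 0) :
    ∃ d, a ∈ relDegLE x Q s κ d := by
  set N : Submodule K (TensorAlgebra K V) := ⨆ d, relDegLE x Q s κ d with hN
  have mem_N {w} : w ∈ N ↔ ∃ d, w ∈ relDegLE x Q s κ d :=
    Submodule.mem_iSup_of_directed _ relDegLE_mono.directed_le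
  have hl (w : TensorAlgebra K V) (hw : w ∈ N) (t : TensorAlgebra K V) : t * w ∈ N := by
    refine left_induction (adjoin_range_tgen x) (N.comap (LinearMap.mulRight K w)) ?_ ?_ t
    · simpa using hw
    · intro i b hb
      obtain ⟨d, hd⟩ := mem_N.1 hb
      rw [LinearMap.mulRight_apply] at hd
      rw [Submodule.mem_comap, LinearMap.mulRight_apply, mul_assoc]
      exact mem_N.2 ⟨_, tgen_mul_mem_relDegLE hd i⟩
  have hr (t : TensorAlgebra K V) : relator x Q s κ * t ∈ N := by
    refine right_induction (adjoin_range_tgen x)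
      (N.comap (LinearMap.mulLeft K (relator x Q s κ))) ?_ ?_ t
    · rw [Submodule.mem_comap, LinearMap.mulLeft_apply, mul_one, ← one_mul (relator x Q s κ)]
      exact mem_N.2 ⟨_, mul_relator_mem_relDegLE (one_mem_degLT x 0)⟩
    · intro i b hb
      obtain ⟨d, hd⟩ := mem_N.1 hb
      rw [LinearMap.mulLeft_apply] at hd
      rw [Submodule.mem_comap, LinearMap.mulLeft_apply, ← mul_assoc]
      exact mem_N.2 ⟨_, mul_tgen_mem_relDegLE hd i⟩
  let φ : TensorAlgebra K V →ₐ[K] Module.End K (TensorAlgebra K V ⧸ N) :=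
    AlgHom.ofLinearMap
      { toFun := fun t => N.mapQ N (LinearMap.mulLeft K t) fun w hw => hl w hw t
        map_add' := fun t t' => by
          ext w
          exact congrArg N.mkQ (add_mul t t' w)
        map_smul' := fun c t => by
          ext w
          exact congrArg N.mkQ (smul_mul_assoc c t w) }
      (by ext w; simp) (fun t t' => by
        ext w
        exact congrArg N.mkQ (mul_assoc t t' w))
  have hφ : ∀ ⦃a b⦄, (a = relator x Q s κ ∧ b = 0) → φ a = φ b := by
    rintro _ _ ⟨rfl, rfl⟩
    rw [map_zero]
    ext w
    exact (Submodule.Quotient.mk_eq_zero N).2 (hr w)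
  have h1 : φ a = 0 := by
    rw [← RingQuot.liftAlgHom_mkAlgHom_apply K φ hφ a, ha, map_zero]
  have h2 : N.mkQ (a * 1) = 0 := LinearMap.congr_fun h1 (N.mkQ 1)
  rw [mul_one, Submodule.mkQ_apply, Submodule.Quotient.mk_eq_zero] at h2
  exact mem_N.1 h2

end Relator

/-! ### The degree filtration of U -/

section Deformation

variable {K : Type u} [Field K] {V : Type v} [AddCommGroup V] [Module K V] {n : ℕ}
  (x : Module.Basis (Fin n) K V) (Q : Matrix (Fin n) (Fin n) K) (s : Fin n → K) (κ : K)

/-- The projection of `T(V)` onto `U = T(V)/(f - v - κ)`. -/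
abbrev defMk : TensorAlgebra K V →ₐ[K] Deformation x Q s κ := RingQuot.mkAlgHom K _

theorem adjoin_range_gen : Algebra.adjoin K (Set.range (gen x Q s κ)) = ⊤ := by
  have : gen x Q s κ = defMk x Q s κ ∘ tgen x := rfl
  rw [this, Set.range_comp, ← AlgHom.map_adjoin, adjoin_range_tgen, Algebra.map_top,
    AlgHom.range_eq_top]
  exact RingQuot.mkAlgHom_surjective K _

theorem defMk_linearCombination (c : Fin n → K) :
    defMk x Q s κ (Fintype.linearCombination K (tgen x) c) =
      Fintype.linearCombination K (gen x Q s κ) c := by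
  simp [Fintype.linearCombination_apply, gen]

/-- The image in `U` of the elements of `T(V)` of degree less than `d`. -/
def defDegLT (d : ℕ) : Submodule K (Deformation x Q s κ) :=
  (degLT x d).map (defMk x Q s κ).toLinearMap

theorem defDegLT_mono : Monotone (defDegLT x Q s κ) := fun _ _ h =>
  Submodule.map_mono (degLT_mono x h)

theorem exists_mem_defDegLT (a : Deformation x Q s κ) : ∃ d, a ∈ defDegLT x Q s κ d := by
  obtain ⟨a, rfl⟩ := RingQuot.mkAlgHom_surjective K _ a
  obtain ⟨d, hd⟩ := exists_mem_degLT x a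
  exact ⟨d, a, hd, rfl⟩

variable {x Q s κ}

/-- Lifted to T(V), the difference between a γ and a lower-degree representative lies in the ideal.
Strictness places it in the correct filtration step, and cancelling γ there lowers the degree of a
modulo relations. -/
theorem mem_defDegLT_of_mul_mem (hn : 2 ≤ n) (hQ : IsUnit Q) {d : ℕ} {a : Deformation x Q s κ}
    {γ : Fin n → K} (hγ : γ ≠ 0) (ha : a ∈ defDegLT x Q s κ (d + 1))
    (h : a * Fintype.linearCombination K (gen x Q s κ) γ ∈ defDegLT x Q s κ (d + 1)) :
    a ∈ defDegLT x Q s κ d := by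
  obtain ⟨a, ha, rfl⟩ := ha
  obtain ⟨c, hc, hca⟩ := h
  have h0 : defMk x Q s κ (a * Fintype.linearCombination K (tgen x) γ - c) = 0 := by
    rw [map_sub, map_mul, defMk_linearCombination, sub_eq_zero]
    exact hca.symm
  obtain ⟨m, hm⟩ := exists_mem_relDegLE h0
  have hm' := relDegLE_inf_degLT_le hn hQ m (d + 1) hm
    (sub_mem (mul_linearCombination_mem_degLT x ha γ) (degLT_le_succ x _ hc))
  have := mem_of_mul_linearCombination_mem (a := a) hn hQ hγ (by
    have := Submodule.add_mem_sup hm' hc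
    rwa [sub_add_cancel] at this)
  obtain ⟨j, hj, b, hb, hjb⟩ := Submodule.mem_sup.1 this
  refine ⟨b, hb, ?_⟩
  have hj0 : ∀ m, ∀ j ∈ relDegLE x Q s κ m, defMk x Q s κ j = 0 := by
    intro m
    induction m with
    | zero => rintro j (rfl : j = 0); exact map_zero _
    | succ m ih =>
      intro j hj
      obtain ⟨b, -, u, hu, rfl⟩ := mem_relDegLE_succ.1 hj
      have hr : defMk x Q s κ (relator x Q s κ) = 0 :=
        (RingQuot.mkAlgHom_rel K ⟨rfl, rfl⟩).trans (map_zero _)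
      simp [hr, ih _ (hu _)]
  rw [← hjb]
  simp [hj0 _ j hj]

end Deformation

/-! ### Linear combinations with coefficients in Q -/

section LinearCombination

variable {K : Type*} [Field K] {n : ℕ} (Q : Matrix (Fin n) (Fin n) K)

theorem sum_linearCombination_mul {B : Type*} [Ring B] [Algebra K B] (g h : Fin n → B) :
    ∑ j, Fintype.linearCombination K g (Q.col j) * h j =
      ∑ i, g i * Fintype.linearCombination K h (Q.row i) := by
  simp only [Fintype.linearCombination_apply, Finset.sum_mul, Finset.mul_sum, smul_mul_assoc,
    mul_smul_comm]
  rw [Finset.sum_comm]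
  rfl

theorem eq_sum_inv_smul_linearCombination {Q : Matrix (Fin n) (Fin n) K} (hQ : IsUnit Q)
    {M : Type*} [AddCommGroup M] [Module K M] (a : Fin n → M) (i : Fin n) :
    a i = ∑ j, Q⁻¹ j i • Fintype.linearCombination K a (Q.col j) := by
  have h : Q * Q⁻¹ = 1 := Matrix.mul_nonsing_inv Q ((Matrix.isUnit_iff_isUnit_det Q).1 hQ)
  simp only [← map_smul, ← map_sum]
  have : ∑ j, Q⁻¹ j i • Q.col j = Pi.single i 1 := by
    ext k
    have := congrFun (congrFun h k) i
    rw [Matrix.mul_apply] at this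
    simp only [Finset.sum_apply, Pi.smul_apply, Matrix.col_apply, smul_eq_mul]
    rw [Matrix.one_apply] at this
    simp only [mul_comm (Q⁻¹ _ _), this, Pi.single_apply]
  rw [this]
  simp

theorem linearCombination_col_ext {Q : Matrix (Fin n) (Fin n) K} (hQ : IsUnit Q)
    {M : Type*} [AddCommGroup M] [Module K M] {a b : Fin n → M}
    (h : ∀ j, Fintype.linearCombination K a (Q.col j) =
      Fintype.linearCombination K b (Q.col j)) : a = b := by
  ext i
  rw [eq_sum_inv_smul_linearCombination hQ a i, eq_sum_inv_smul_linearCombination hQ b i]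
  simp only [h]

end LinearCombination

/-! ### The universal property of U -/

section UniversalProperty

variable {K : Type u} [Field K] {V : Type v} [AddCommGroup V] [Module K V] {n : ℕ}
  (x : Module.Basis (Fin n) K V) (Q : Matrix (Fin n) (Fin n) K) (s : Fin n → K) (κ : K)

theorem sum_linearCombination_mul_gen :
    ∑ j, Fintype.linearCombination K (gen x Q s κ) (Q.col j) * gen x Q s κ j =
      ∑ j, s j • gen x Q s κ j + algebraMap K _ κ := by
  have hr : defMk x Q s κ (relator x Q s κ) = 0 :=
    (RingQuot.mkAlgHom_rel K ⟨rfl, rfl⟩).trans (map_zero _)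
  have h := hr.symm.trans (congrArg (defMk x Q s κ) (relator_eq x Q s κ))
  rw [map_sub, map_sub, sub_sub, eq_comm, sub_eq_zero, map_sum, map_sum, AlgHom.commutes] at h
  simp only [map_mul, defMk_linearCombination, map_smul] at h
  exact h

variable {x Q s κ}
variable {B : Type*} [Ring B] [Algebra K B]

/-- The universal property of `U = T(V)/(f - v - κ)`. -/
def defLift (w : Fin n → B)
    (hw : ∑ j, Fintype.linearCombination K w (Q.col j) * w j =
      ∑ j, s j • w j + algebraMap K _ κ) : Deformation x Q s κ →ₐ[K] B :=
  RingQuot.liftAlgHom K ⟨TensorAlgebra.lift K (x.constr K w), by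
    rintro _ _ ⟨rfl, rfl⟩
    have h (i) : TensorAlgebra.lift K (x.constr K w) (tgen x i) = w i := by simp [tgen]
    rw [map_zero, relator_eq, map_sub, map_sub, sub_sub, sub_eq_zero, map_sum, map_sum,
      AlgHom.commutes]
    simp only [map_mul, Fintype.linearCombination_apply, map_sum, map_smul, h]
    exact hw⟩

theorem defLift_gen (w : Fin n → B)
    (hw : ∑ j, Fintype.linearCombination K w (Q.col j) * w j =
      ∑ j, s j • w j + algebraMap K _ κ) (i : Fin n) :
    defLift (x := x) w hw (gen x Q s κ i) = w i := by
  rw [defLift, gen, RingQuot.liftAlgHom_mkAlgHom_apply]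
  simp

theorem deformation_hom_ext {F G : Deformation x Q s κ →ₐ[K] B}
    (h : ∀ i, F (gen x Q s κ i) = G (gen x Q s κ i)) : F = G := by
  refine AlgHom.ext_of_adjoin_eq_top (adjoin_range_gen x Q s κ) ?_
  rintro _ ⟨i, rfl⟩
  exact h i

end UniversalProperty

/-! ### The automorphism ξ -/

section Nakayama

variable {K : Type u} [Field K] {V : Type v} [AddCommGroup V] [Module K V] {n : ℕ}
  (x : Module.Basis (Fin n) K V) (Q : Matrix (Fin n) (Fin n) K) (s : Fin n → K) (κ : K)

/-- The elements `-𝐱 S R⁻¹ + 𝐬 R⁻¹` of `U`. -/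
def substGen (R S : Matrix (Fin n) (Fin n) K) (j : Fin n) : Deformation x Q s κ :=
  -Fintype.linearCombination K (gen x Q s κ) ((S * R⁻¹).col j) +
    algebraMap K _ (Matrix.vecMul s R⁻¹ j)

/-- Combining with the columns of R clears R⁻¹. With R = Q and S = Qᵗ this is the usable form ξ(Y_j)
= s_j - Z_j. -/
theorem linearCombination_substGen {R : Matrix (Fin n) (Fin n) K} (hR : IsUnit R)
    (S : Matrix (Fin n) (Fin n) K) (j : Fin n) :
    Fintype.linearCombination K (substGen x Q s κ R S) (R.col j) =
      algebraMap K _ (s j) - Fintype.linearCombination K (gen x Q s κ) (S.col j) := by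
  have h : R⁻¹ * R = 1 := Matrix.nonsing_inv_mul R ((Matrix.isUnit_iff_isUnit_det R).1 hR)
  have h1 : ∑ i, R.col j i • (S * R⁻¹).col i = S.col j := by
    have h2 : S * R⁻¹ * R = S := by rw [Matrix.mul_assoc, h, Matrix.mul_one]
    ext k
    simp only [Finset.sum_apply, Pi.smul_apply, Matrix.col_apply, smul_eq_mul]
    conv_rhs => rw [← h2, Matrix.mul_apply]
    exact Finset.sum_congr rfl fun i _ => mul_comm _ _
  have h3 : ∑ i, R.col j i * Matrix.vecMul s R⁻¹ i = s j := by
    have h2 : Matrix.vecMul (Matrix.vecMul s R⁻¹) R = s := by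
      rw [Matrix.vecMul_vecMul, h, Matrix.vecMul_one]
    conv_rhs => rw [← h2, Matrix.vecMul, dotProduct]
    exact Finset.sum_congr rfl fun i _ => mul_comm _ _
  rw [Fintype.linearCombination_apply]
  simp only [substGen, smul_add, smul_neg, Finset.sum_add_distrib, Finset.sum_neg_distrib,
    Algebra.algebraMap_eq_smul_one, smul_smul, ← Finset.sum_smul, h3, ← map_smul, ← map_sum, h1]
  abel

variable {Q}

/-- The endomorphism `𝐱 ↦ -𝐱 Qᵗ Q⁻¹ + 𝐬 Q⁻¹` of `U`. -/
def nakayamaHom (hQ : IsUnit Q) : Deformation x Q s κ →ₐ[K] Deformation x Q s κ :=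
  defLift (substGen x Q s κ Q Q.transpose) (by
    -- ∑ ξ(Y_j) ξ(x_j) = ∑ s_j ξ(x_j) - ∑ Z_j ξ(x_j). Regrouping, ∑ Z_j ξ(x_j) = ∑ x_i ξ(Y_i) = ∑
    -- s_i x_i - ∑ x_i Z_i = -κ.
    simp only [linearCombination_substGen x Q s κ hQ, sub_mul, Finset.sum_sub_distrib,
      ← Algebra.smul_def]
    rw [sub_eq_add_neg, add_right_inj, sum_linearCombination_mul]
    change -∑ i, _ * Fintype.linearCombination K _ (Q.col i) = _
    simp only [linearCombination_substGen x Q s κ hQ, mul_sub, Finset.sum_sub_distrib,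
      ← Algebra.commutes, ← Algebra.smul_def]
    change -(_ - ∑ i, _ * Fintype.linearCombination K _ (Q.row i)) = _
    rw [← sum_linearCombination_mul, sum_linearCombination_mul_gen]
    abel)

/-- The inverse of `nakayamaHom`. -/
def nakayamaInv (hQ : IsUnit Q) : Deformation x Q s κ →ₐ[K] Deformation x Q s κ :=
  defLift (substGen x Q s κ Q.transpose Q) (by
    have hT : IsUnit Q.transpose := (Matrix.isUnit_transpose Q).2 hQ
    rw [sum_linearCombination_mul]
    change ∑ i, _ * Fintype.linearCombination K _ (Q.transpose.col i) = _
    simp only [linearCombination_substGen x Q s κ hT, mul_sub, Finset.sum_sub_distrib,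
      ← Algebra.commutes, ← Algebra.smul_def]
    rw [sub_eq_add_neg, add_right_inj]
    change -∑ i, _ * Fintype.linearCombination K _ (Q.transpose.row i) = _
    rw [← sum_linearCombination_mul]
    simp only [linearCombination_substGen x Q s κ hT, sub_mul, Finset.sum_sub_distrib,
      ← Algebra.smul_def]
    rw [sum_linearCombination_mul_gen]
    abel)

theorem map_linearCombination_gen {B : Type*} [Ring B] [Algebra K B]
    (F : Deformation x Q s κ →ₐ[K] B) (c : Fin n → K) :
    F (Fintype.linearCombination K (gen x Q s κ) c) =
      Fintype.linearCombination K (fun i => F (gen x Q s κ i)) c := by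
  simp [Fintype.linearCombination_apply]

theorem nakayamaHom_col (hQ : IsUnit Q) (j : Fin n) :
    nakayamaHom x s κ hQ (Fintype.linearCombination K (gen x Q s κ) (Q.col j)) =
      algebraMap K _ (s j) - Fintype.linearCombination K (gen x Q s κ) (Q.row j) := by
  simp only [map_linearCombination_gen, nakayamaHom, defLift_gen]
  exact linearCombination_substGen x Q s κ hQ _ j

theorem nakayamaInv_row (hQ : IsUnit Q) (j : Fin n) :
    nakayamaInv x s κ hQ (Fintype.linearCombination K (gen x Q s κ) (Q.row j)) =
      algebraMap K _ (s j) - Fintype.linearCombination K (gen x Q s κ) (Q.col j) := by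
  simp only [map_linearCombination_gen, nakayamaInv, defLift_gen]
  exact linearCombination_substGen x Q s κ ((Matrix.isUnit_transpose Q).2 hQ) _ j

/-- The automorphism `𝐱 ↦ -𝐱 Qᵗ Q⁻¹ + 𝐬 Q⁻¹` of `U`. -/
def nakayama (hQ : IsUnit Q) : Deformation x Q s κ ≃ₐ[K] Deformation x Q s κ :=
  AlgEquiv.ofAlgHom (nakayamaHom x s κ hQ) (nakayamaInv x s κ hQ)
    (deformation_hom_ext fun i => by
      -- Since Q is invertible, it suffices to compare the two maps on the Z_j, where both
      -- substitutions are simple.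
      refine congrFun (linearCombination_col_ext ((Matrix.isUnit_transpose Q).2 hQ)
        (a := fun i => (nakayamaHom x s κ hQ).comp (nakayamaInv x s κ hQ) (gen x Q s κ i))
        (b := fun i => AlgHom.id K _ (gen x Q s κ i)) (fun j => ?_)) i
      rw [← map_linearCombination_gen, ← map_linearCombination_gen]
      change nakayamaHom x s κ hQ (nakayamaInv x s κ hQ
        (Fintype.linearCombination K (gen x Q s κ) (Q.row j))) =
          Fintype.linearCombination K (gen x Q s κ) (Q.row j)
      rw [nakayamaInv_row, map_sub, nakayamaHom_col, AlgHom.commutes]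
      abel)
    (deformation_hom_ext fun i => by
      refine congrFun (linearCombination_col_ext hQ
        (a := fun i => (nakayamaInv x s κ hQ).comp (nakayamaHom x s κ hQ) (gen x Q s κ i))
        (b := fun i => AlgHom.id K _ (gen x Q s κ i)) (fun j => ?_)) i
      rw [← map_linearCombination_gen, ← map_linearCombination_gen]
      change nakayamaInv x s κ hQ (nakayamaHom x s κ hQ
        (Fintype.linearCombination K (gen x Q s κ) (Q.col j))) =
          Fintype.linearCombination K (gen x Q s κ) (Q.col j)
      rw [nakayamaHom_col, map_sub, nakayamaInv_row, AlgHom.commutes]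
      abel)

theorem nakayama_gen (hQ : IsUnit Q) (j : Fin n) : nakayama x s κ hQ (gen x Q s κ j) =
    -(∑ i, (Q.transpose * Q⁻¹) i j • gen x Q s κ i) +
      algebraMap K _ (Matrix.vecMul s Q⁻¹ j) :=
  defLift_gen _ _ j

theorem nakayama_col (hQ : IsUnit Q) (j : Fin n) :
    nakayama x s κ hQ (Fintype.linearCombination K (gen x Q s κ) (Q.col j)) =
      algebraMap K _ (s j) - Fintype.linearCombination K (gen x Q s κ) (Q.row j) :=
  nakayamaHom_col x s κ hQ j

end Nakayama

/-! ### The enveloping algebra: multiplication, contractions and the twisted flip -/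

section Enveloping

variable {K : Type u} [Field K] {A : Type v} [Ring A] [Algebra K A] {n : ℕ}

theorem env_induction {P : Env K A → Prop} (h0 : P 0) (hadd : ∀ s t, P s → P t → P (s + t))
    (htmul : ∀ a b : A, P (a ⊗ₜ op b)) (t : Env K A) : P t := by
  induction t using TensorProduct.induction_on with
  | zero => exact h0
  | add s t hs ht => exact hadd s t hs ht
  | tmul a b => exact htmul a b.unop

variable (K) in
/-- The element `a ⊗ 1 - 1 ⊗ a` of the enveloping algebra. -/
def envDelta (a : A) : Env K A := a ⊗ₜ 1 - 1 ⊗ₜ op a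

variable (K A) in
/-- The multiplication map `a ⊗ b ↦ a b`. -/
def envMul : Env K A →ₗ[K] A :=
  LinearMap.applyₗ 1 ∘ₗ (AlgHom.mulLeftRight K A).toLinearMap

theorem envMul_tmul (a b : A) : envMul K A (a ⊗ₜ op b) = a * b := by
  simp [envMul]

theorem envMul_mul_envDelta (t : Env K A) (a : A) : envMul K A (t * envDelta K a) = 0 := by
  induction t using env_induction with
  | h0 => simp
  | hadd s t hs ht => rw [add_mul, map_add, hs, ht, add_zero]
  | htmul b c =>
    rw [envDelta, mul_sub, Algebra.TensorProduct.tmul_mul_tmul, Algebra.TensorProduct.tmul_mul_tmul,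
      mul_one, mul_one, ← op_mul, map_sub, envMul_tmul, envMul_tmul, mul_assoc, sub_self]

variable {g : Fin n → A}

/-- The kernel of the multiplication `Aᵉ → A` is generated by the elements `g_i ⊗ 1 - 1 ⊗ g_i`. -/
theorem mem_span_envDelta (hg : Algebra.adjoin K (Set.range g) = ⊤) {t : Env K A}
    (ht : envMul K A t = 0) :
    ∃ u : Fin n → Env K A, ∑ i, u i * envDelta K (g i) = t := by
  set N : Submodule (Env K A) (Env K A) := Submodule.span _ (Set.range fun i => envDelta K (g i))
    with hN
  suffices h : t ∈ N from (Submodule.mem_span_range_iff_exists_fun _).1 h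
  have h1 (b : A) : envDelta K b ∈ N := by
    refine left_induction hg ((N.restrictScalars K).comap
      ((TensorProduct.mk K A Aᵐᵒᵖ).flip 1 -
        TensorProduct.mk K A Aᵐᵒᵖ 1 ∘ₗ (opLinearEquiv K).toLinearMap)) ?_ ?_ b
    · change (1 : A) ⊗ₜ[K] (1 : Aᵐᵒᵖ) - 1 ⊗ₜ op 1 ∈ N
      simp
    · intro i b (hb : envDelta K b ∈ N)
      change envDelta K (g i * b) ∈ N
      -- Leibniz rule for the universal derivation b ↦ b ⊗ 1 - 1 ⊗ b.
      have : envDelta K (g i * b) = (g i ⊗ₜ 1) * envDelta K b +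
          (1 ⊗ₜ op b) * envDelta K (g i) := by
        simp [envDelta, mul_sub, Algebra.TensorProduct.tmul_mul_tmul]
      rw [this]
      exact add_mem (N.smul_mem _ hb) (N.smul_mem _ (Submodule.subset_span ⟨i, rfl⟩))
  have h2 (t : Env K A) : t - envMul K A t ⊗ₜ 1 ∈ N := by
    induction t using env_induction with
    | h0 => simp
    | hadd s t hs ht =>
      rw [map_add, TensorProduct.add_tmul, add_sub_add_comm]
      exact add_mem hs ht
    | htmul a b =>
      have : a ⊗ₜ op b - (a * b) ⊗ₜ 1 = -(a ⊗ₜ[K] (1 : Aᵐᵒᵖ) * envDelta K b) := by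
        rw [envDelta, mul_sub, Algebra.TensorProduct.tmul_mul_tmul,
          Algebra.TensorProduct.tmul_mul_tmul]
        simp
      rw [envMul_tmul, this]
      exact N.neg_mem (N.smul_mem _ (h1 b))
  have := h2 t
  rwa [ht, TensorProduct.zero_tmul, sub_zero] at this

/-- The map `1 ⊗ φ : Aᵉ → A` for a linear form `φ`. -/
def contract (φ : Aᵐᵒᵖ →ₗ[K] K) : Env K A →ₗ[K] A :=
  (TensorProduct.rid K A).toLinearMap ∘ₗ φ.lTensor A

theorem contract_tmul (φ : Aᵐᵒᵖ →ₗ[K] K) (a : A) (b : Aᵐᵒᵖ) :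
    contract φ (a ⊗ₜ b) = φ b • a := by
  simp [contract]

theorem contract_mul_tmul_one (φ : Aᵐᵒᵖ →ₗ[K] K) (t : Env K A) (y : A) :
    contract φ (t * y ⊗ₜ 1) = contract φ t * y := by
  induction t using env_induction with
  | h0 => simp
  | hadd s t hs ht => simp only [add_mul, map_add, hs, ht]
  | htmul a b => simp [contract_tmul, Algebra.TensorProduct.tmul_mul_tmul]

theorem contract_mul_one_tmul (φ : Aᵐᵒᵖ →ₗ[K] K) (t : Env K A) (z : Aᵐᵒᵖ) :
    contract φ (t * 1 ⊗ₜ z) = contract (φ ∘ₗ LinearMap.mulRight K z) t := by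
  induction t using env_induction with
  | h0 => simp
  | hadd s t hs ht => simp only [add_mul, map_add, hs, ht]
  | htmul a b => simp [contract_tmul, Algebra.TensorProduct.tmul_mul_tmul]

/-- The contractions with the coordinate forms of a basis of Aᵐᵒᵖ are the coordinates of t over A.
-/
theorem eq_zero_of_contract {t : Env K A} (h : ∀ φ, contract φ t = 0) : t = 0 := by
  let b := Module.Basis.ofVectorSpace K Aᵐᵒᵖ
  classical
  refine (TensorProduct.equivFinsuppOfBasisRight (M := A) b).injective ?_
  rw [map_zero]
  ext i
  refine Eq.trans ?_ (h (b.coord i))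
  clear h
  induction t using TensorProduct.induction_on with
  | zero => simp
  | add s t hs ht => simp only [map_add, Finsupp.add_apply, hs, ht]
  | tmul a c =>
    rw [contract_tmul, TensorProduct.equivFinsuppOfBasisRight_apply_tmul_apply]
    rfl

variable (K A) in
/-- For an automorphism `ξ`, the linear automorphism `a ⊗ b ↦ b ⊗ ξ(a)` of `Aᵉ`. -/
def twistFlip (ξ : A ≃ₐ[K] A) : Env K A ≃ₗ[K] Env K A :=
  (TensorProduct.comm K A Aᵐᵒᵖ).trans (TensorProduct.congr (opLinearEquiv K).symm
    (ξ.toLinearEquiv.trans (opLinearEquiv K)))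

theorem twistFlip_tmul (ξ : A ≃ₐ[K] A) (a b : A) :
    twistFlip K A ξ (a ⊗ₜ op b) = b ⊗ₜ op (ξ a) := rfl

/-- Reversing products is what lets the flip turn the dual complex, made of left multiplications,
into the resolution, made of right multiplications. -/
theorem twistFlip_mul (ξ : A ≃ₐ[K] A) (s t : Env K A) :
    twistFlip K A ξ (s * t) = twistFlip K A ξ t * twistFlip K A ξ s := by
  induction s using env_induction with
  | h0 => simp
  | hadd s s' hs hs' => simp only [add_mul, mul_add, map_add, hs, hs']
  | htmul a b =>
    induction t using env_induction with
    | h0 => simp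
    | hadd t t' ht ht' => simp only [add_mul, mul_add, map_add, ht, ht']
    | htmul c d =>
      rw [Algebra.TensorProduct.tmul_mul_tmul, twistFlip_tmul, twistFlip_tmul, ← op_mul,
        twistFlip_tmul, Algebra.TensorProduct.tmul_mul_tmul, map_mul, op_mul]

end Enveloping

/-! ### Algebras presented by one quadratic relation -/

section Presentation

variable {K : Type u} [Field K] {A : Type v} [Ring A] [Algebra K A] {n : ℕ}

/-- The noncommutative partial derivatives of `f - v - κ` in `Aᵉ`, evaluated at `g`. -/
def relDeriv (g : Fin n → A) (Q : Matrix (Fin n) (Fin n) K) (s : Fin n → K) (j : Fin n) :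
    Env K A :=
  Fintype.linearCombination K g (Q.col j) ⊗ₜ 1 +
    1 ⊗ₜ op (Fintype.linearCombination K g (Q.row j) - algebraMap K _ (s j))

/-- `A` is presented by the generators `g_i` and the single relation `f - v - κ = 0`, and the
partial derivatives of the relation have no common left annihilator in `Aᵉ`. -/
structure IsRegularPresentation (g : Fin n → A) (Q : Matrix (Fin n) (Fin n) K) (s : Fin n → K)
    (κ : K) : Prop where
  adjoin_eq_top : Algebra.adjoin K (Set.range g) = ⊤
  relation : ∑ j, Fintype.linearCombination K g (Q.col j) * g j =
    ∑ j, s j • g j + algebraMap K A κ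
  exists_lift : ∀ (B : Type v) [Ring B] [Algebra K B] (w : Fin n → B),
    ∑ j, Fintype.linearCombination K w (Q.col j) * w j = ∑ j, s j • w j + algebraMap K B κ →
      ∃ ρ : A →ₐ[K] B, ∀ i, ρ (g i) = w i
  eq_zero : ∀ t : Env K A, (∀ j, t * relDeriv g Q s j = 0) → t = 0

variable {g : Fin n → A} {Q : Matrix (Fin n) (Fin n) K} {s : Fin n → K} {κ : K}

/-- The sum telescopes: the mixed terms ∑ Y_j ⊗ x_j and ∑ x_j ⊗ Z_j cancel, and the relation reduces
the rest to κ ⊗ 1 - 1 ⊗ κ = 0. -/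
theorem IsRegularPresentation.sum_relDeriv_mul_envDelta (H : IsRegularPresentation g Q s κ) :
    ∑ j, relDeriv g Q s j * envDelta K (g j) = 0 := by
  have h1 := H.relation
  have h2 := h1
  rw [sum_linearCombination_mul] at h2
  have h3 : ∑ j, Fintype.linearCombination K (g) (Q.col j) ⊗ₜ[K] op (g j) =
      ∑ j, g j ⊗ₜ op (Fintype.linearCombination K (g) (Q.row j)) := by
    simp only [Fintype.linearCombination_apply, TensorProduct.sum_tmul, Finset.op_sum, op_smul,
      TensorProduct.tmul_sum, TensorProduct.tmul_smul, ← TensorProduct.smul_tmul']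
    rw [Finset.sum_comm]
    rfl
  have h4 (j : Fin n) : relDeriv g Q s j * envDelta K (g j) =
      (Fintype.linearCombination K (g) (Q.col j) * g j -
        s j • g j) ⊗ₜ 1 -
      Fintype.linearCombination K (g) (Q.col j) ⊗ₜ[K] op (g j) +
      g j ⊗ₜ op (Fintype.linearCombination K (g) (Q.row j)) -
      1 ⊗ₜ op (g j * Fintype.linearCombination K (g) (Q.row j) -
        s j • g j) := by
    simp only [relDeriv, envDelta, add_mul, mul_sub, sub_mul,
      Algebra.TensorProduct.tmul_mul_tmul, one_mul, mul_one, op_sub, op_mul, op_smul,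
      Algebra.algebraMap_eq_smul_one, TensorProduct.tmul_sub, TensorProduct.sub_tmul,
      op_one, TensorProduct.tmul_smul, ← TensorProduct.smul_tmul', smul_mul_assoc]
    abel
  simp only [h4, Finset.sum_add_distrib, Finset.sum_sub_distrib, ← TensorProduct.sum_tmul,
    ← TensorProduct.tmul_sum, ← Finset.op_sum]
  rw [h1, h2, h3]
  simp [Algebra.algebraMap_eq_smul_one, ← TensorProduct.smul_tmul']

end Presentation

/-! ### Injectivity on the left of the resolution -/

section Exactness

variable {K : Type u} [Field K] {V : Type v} [AddCommGroup V] [Module K V] {n : ℕ}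
  (x : Module.Basis (Fin n) K V) (Q : Matrix (Fin n) (Fin n) K) (s : Fin n → K) (κ : K)

variable {x Q s κ}

/-- Descent on a degree bound shared by all contractions of t. Contracting t r_j = 0 shows that a
contraction times Y_j is minus another contraction of t, hence within the same bound; so every
contraction has smaller degree. A single j is enough. -/
theorem eq_zero_of_mul_relDeriv (hn : 2 ≤ n) (hQ : IsUnit Q) {t : Env K (Deformation x Q s κ)}
    (ht : ∀ j, t * relDeriv (gen x Q s κ) Q s j = 0) : t = 0 := by
  let j : Fin n := ⟨0, by omega⟩
  have hcol : Q.col j ≠ 0 := fun h0 => by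
    have h1 := Matrix.mulVec_injective_iff_isUnit.2 hQ
    have := @h1 (Pi.single j 1) 0
      (by rw [Matrix.mulVec_single_one, h0, Matrix.mulVec_zero])
    simpa using congrFun this j
  have hd : ∃ d, ∀ φ, contract φ t ∈ defDegLT x Q s κ d := by
    clear ht
    induction t using TensorProduct.induction_on with
    | zero => exact ⟨0, fun φ => by rw [map_zero]; exact zero_mem _⟩
    | add t t' h h' =>
      obtain ⟨d, hd⟩ := h
      obtain ⟨d', hd'⟩ := h'
      refine ⟨max d d', fun φ => ?_⟩
      rw [map_add]
      exact add_mem (defDegLT_mono x Q s κ (le_max_left _ _) (hd φ))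
        (defDegLT_mono x Q s κ (le_max_right _ _) (hd' φ))
    | tmul a b =>
      obtain ⟨d, hd⟩ := exists_mem_defDegLT x Q s κ a
      refine ⟨d, fun φ => ?_⟩
      rw [contract_tmul]
      exact Submodule.smul_mem _ _ hd
  obtain ⟨d, hd⟩ := hd
  induction d with
  | zero =>
    refine eq_zero_of_contract fun φ => ?_
    have := hd φ
    simpa [defDegLT, degLT] using this
  | succ d ih =>
    refine ih fun φ => mem_defDegLT_of_mul_mem hn hQ hcol (hd φ) ?_
    have h := congrArg (contract φ) (ht j)
    rw [relDeriv, mul_add, map_add, map_zero, contract_mul_tmul_one, contract_mul_one_tmul] at h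
    rw [eq_neg_of_add_eq_zero_left h]
    exact neg_mem (hd _)

theorem isRegularPresentation_gen (hn : 2 ≤ n) (hQ : IsUnit Q) :
    IsRegularPresentation (gen x Q s κ) Q s κ where
  adjoin_eq_top := adjoin_range_gen x Q s κ
  relation := sum_linearCombination_mul_gen x Q s κ
  exists_lift _ _ _ w hw := ⟨defLift w hw, defLift_gen w hw⟩
  eq_zero _ ht := eq_zero_of_mul_relDeriv hn hQ ht

end Exactness

/-! ### Derivations and exactness in the middle -/

section MiddleExactness

variable {K : Type u} [Field K] {A : Type v} [Ring A] [Algebra K A] {n : ℕ}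
  {g : Fin n → A} {Q : Matrix (Fin n) (Fin n) K} {s : Fin n → K} {κ : K}
  {M : Type v} [AddCommGroup M] [Module (Env K A) M] [Module K M]
  [IsScalarTower K (Env K A) M]

variable (K g) in
/-- The operator `(u, m) ↦ (x_i u, x_i m + dx_i u)` on `A × M`. -/
def derivOp (dx : Fin n → M) (i : Fin n) : Module.End K (A × M) where
  toFun p := (g i * p.1,
    (g i ⊗ₜ 1 : Env K A) • p.2 +
      (1 ⊗ₜ op p.1 : Env K A) • dx i)
  map_add' p q := by
    simp only [Prod.fst_add, Prod.snd_add, mul_add, smul_add, op_add, TensorProduct.tmul_add,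
      add_smul, Prod.mk_add_mk]
    congr 1
    abel
  map_smul' c p := by
    simp only [Prod.smul_fst, Prod.smul_snd, mul_smul_comm, op_smul, TensorProduct.tmul_smul,
      smul_assoc, RingHom.id_apply, Prod.smul_mk, smul_add]
    rw [smul_comm]

theorem derivOp_apply (dx : Fin n → M) (i : Fin n) (p : A × M) :
    derivOp K g dx i p = (g i * p.1,
      (g i ⊗ₜ 1 : Env K A) • p.2 +
        (1 ⊗ₜ op p.1 : Env K A) • dx i) := rfl

theorem linearCombination_derivOp (dx : Fin n → M) (c : Fin n → K)
    (p : A × M) :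
    Fintype.linearCombination K (derivOp K g dx) c p =
      (Fintype.linearCombination K g c * p.1,
        (Fintype.linearCombination K g c ⊗ₜ 1 : Env K A) • p.2 +
        (1 ⊗ₜ op p.1 : Env K A) • Fintype.linearCombination K dx c) := by
  simp only [Fintype.linearCombination_apply, LinearMap.sum_apply, LinearMap.smul_apply,
    derivOp_apply, Prod.smul_mk, Finset.sum_mul, smul_mul_assoc, TensorProduct.sum_tmul,
    ← TensorProduct.smul_tmul', Finset.sum_smul, Finset.smul_sum, smul_add, smul_assoc,
    ← Finset.sum_add_distrib]
  rw [Prod.ext_iff, Prod.fst_sum, Prod.snd_sum]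
  refine ⟨rfl, Finset.sum_congr rfl fun i _ => ?_⟩
  exact congrArg₂ (· + ·) rfl (smul_comm _ _ _)

/-- `derivOp` is left multiplication by (x_i, dx_i) in the square-zero extension of A by M. The
first component of the relation is the relation in A, and the second is its derivative, which
vanishes by `hdx`. -/
theorem IsRegularPresentation.derivOp_relation (H : IsRegularPresentation g Q s κ) (dx : Fin n → M) (hdx : ∑ j, relDeriv g Q s j • dx j = 0) :
    ∑ j, Fintype.linearCombination K (derivOp K g dx) (Q.col j) * derivOp K g dx j =
      ∑ j, s j • derivOp K g dx j + algebraMap K (Module.End K (A × M)) κ := by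
  have hU := H.relation
  refine LinearMap.ext fun p => ?_
  simp only [LinearMap.sum_apply, Module.End.mul_apply, linearCombination_derivOp,
    LinearMap.add_apply, LinearMap.smul_apply, Module.algebraMap_end_apply, derivOp_apply]
  rw [Prod.ext_iff]
  simp only [Prod.fst_sum, Prod.snd_sum, Prod.fst_add, Prod.snd_add, Prod.smul_fst,
    Prod.smul_snd]
  constructor
  · simp only [← mul_assoc, ← smul_mul_assoc, ← Finset.sum_mul]
    rw [hU, add_mul, Algebra.smul_def]
  · have h1 : ∑ j, (1 ⊗ₜ op (g j) : Env K A) •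
        Fintype.linearCombination K dx (Q.col j) =
        ∑ j, (1 ⊗ₜ op (Fintype.linearCombination K g (Q.row j)) :
          Env K A) • dx j := by
      simp only [Fintype.linearCombination_apply, Finset.smul_sum, Finset.op_sum, op_smul,
        TensorProduct.tmul_sum, TensorProduct.tmul_smul, Finset.sum_smul, smul_assoc]
      rw [Finset.sum_comm]
      refine Finset.sum_congr rfl fun i _ => Finset.sum_congr rfl fun j _ => ?_
      rw [smul_comm]
      rfl
    have h2 : ∑ j, (Fintype.linearCombination K g (Q.col j) ⊗ₜ 1 :
        Env K A) • dx j +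
        ∑ j, (1 ⊗ₜ op (g j) : Env K A) •
          Fintype.linearCombination K dx (Q.col j) = ∑ j, s j • dx j := by
      rw [h1, ← sub_eq_zero, ← hdx, ← Finset.sum_add_distrib, ← Finset.sum_sub_distrib]
      refine Finset.sum_congr rfl fun j _ => ?_
      rw [relDeriv, op_sub, TensorProduct.tmul_sub, ← add_sub_assoc, sub_smul, add_smul,
        Algebra.algebraMap_eq_smul_one, op_smul, TensorProduct.tmul_smul, smul_assoc, op_one,
        ← Algebra.TensorProduct.one_def, one_smul]
    have h3 : (∑ j, Fintype.linearCombination K g (Q.col j) * g j) ⊗ₜ[K]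
        (1 : Aᵐᵒᵖ) =
        ∑ j, s j • (g j ⊗ₜ[K] (1 : Aᵐᵒᵖ)) +
          κ • (1 : Env K A) := by
      rw [hU, TensorProduct.add_tmul, TensorProduct.sum_tmul, Algebra.algebraMap_eq_smul_one,
        ← TensorProduct.smul_tmul', Algebra.TensorProduct.one_def]
      simp only [TensorProduct.smul_tmul']
    have h4 (j : Fin n) :
        (Fintype.linearCombination K g (Q.col j) ⊗ₜ 1 :
          Env K A) •
          ((g j ⊗ₜ 1 : Env K A) • p.2 +
            (1 ⊗ₜ op p.1 : Env K A) • dx j) +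
          (1 ⊗ₜ op (g j * p.1) : Env K A) •
            Fintype.linearCombination K dx (Q.col j) =
        ((Fintype.linearCombination K g (Q.col j) * g j) ⊗ₜ 1 :
          Env K A) • p.2 +
        (1 ⊗ₜ op p.1 : Env K A) •
          ((Fintype.linearCombination K g (Q.col j) ⊗ₜ 1 :
            Env K A) • dx j +
          (1 ⊗ₜ op (g j) : Env K A) •
            Fintype.linearCombination K dx (Q.col j)) := by
      simp only [smul_add, smul_smul, Algebra.TensorProduct.tmul_mul_tmul, one_mul, mul_one,
        op_mul]
      abel
    simp only [h4, Finset.sum_add_distrib, ← Finset.sum_smul, ← Finset.smul_sum,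
      ← TensorProduct.sum_tmul]
    rw [h2, h3, add_smul, Finset.sum_smul, smul_assoc, one_smul]
    simp only [smul_add, Finset.sum_add_distrib, Finset.smul_sum, smul_assoc]
    rw [add_right_comm]
    congr 2
    exact Finset.sum_congr rfl fun j _ => smul_comm _ _ _

theorem IsRegularPresentation.exists_derivHom (H : IsRegularPresentation g Q s κ) (dx : Fin n → M) (hdx : ∑ j, relDeriv g Q s j • dx j = 0) :
    ∃ ρ : A →ₐ[K] Module.End K (A × M),
      ∀ i, ρ (g i) = derivOp K g dx i :=
  H.exists_lift _ (derivOp K g dx) (H.derivOp_relation dx hdx)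

/-- A bimodule derivation of `A` is determined by its values on the generators, which may be
arbitrary subject to the derivative of the relation. -/
theorem IsRegularPresentation.exists_derivation (H : IsRegularPresentation g Q s κ) (dx : Fin n → M) (hdx : ∑ j, relDeriv g Q s j • dx j = 0) :
    ∃ D : A →ₗ[K] M, D 1 = 0 ∧ ∀ i b, D (g i * b) =
      (g i ⊗ₜ 1 : Env K A) • D b +
        (1 ⊗ₜ op b : Env K A) • dx i := by
  obtain ⟨ρ, hρ'⟩ := H.exists_derivHom dx hdx
  have hρ (i) (b : A) (p : A × M) :
      ρ (g i * b) p = derivOp K g dx i (ρ b p) := by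
    rw [map_mul, Module.End.mul_apply]
    exact LinearMap.congr_fun (hρ' i) _
  have h1 (b : A) : (ρ b (1, 0)).1 = b := by
    have hl : (LinearMap.fst K _ M ∘ₗ LinearMap.applyₗ (1, 0)) ∘ₗ ρ.toLinearMap =
        LinearMap.id := by
      refine LinearMap.ext fun b => ?_
      refine left_induction (H.adjoin_eq_top) (LinearMap.eqLocus _ _) ?_ ?_ b
      · rw [LinearMap.mem_eqLocus]
        simp
      · intro i b hb
        rw [LinearMap.mem_eqLocus] at hb ⊢
        simp only [LinearMap.comp_apply, AlgHom.toLinearMap_apply, LinearMap.applyₗ_apply_apply,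
          LinearMap.fst_apply, LinearMap.id_apply] at hb ⊢
        rw [hρ, derivOp_apply, hb]
    exact LinearMap.congr_fun hl b
  refine ⟨LinearMap.snd K _ M ∘ₗ LinearMap.applyₗ (1, 0) ∘ₗ ρ.toLinearMap, by simp,
    fun i b => ?_⟩
  change (ρ (g i * b) (1, 0)).2 = _ • (ρ b (1, 0)).2 + _
  rw [hρ, derivOp_apply, h1]

/-- If D is the derivation with D x_i = dx_i, the map a ⊗ b ↦ a D(b) sends t δ_i to -t dx_i, so a
relation among the δ_i becomes one among the dx_i. -/
theorem IsRegularPresentation.sum_smul_eq_zero (H : IsRegularPresentation g Q s κ) (dx : Fin n → M) (hdx : ∑ j, relDeriv g Q s j • dx j = 0)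
    {t : Fin n → Env K A} (ht : ∑ i, t i * envDelta K (g i) = 0) :
    ∑ i, t i • dx i = 0 := by
  obtain ⟨D, -, hD⟩ := H.exists_derivation dx hdx
  let h : Env K A →ₗ[K] M :=
    TensorProduct.lift (LinearMap.mk₂ K
      (fun a b => (a ⊗ₜ 1 : Env K A) • D b.unop)
      (fun a a' b => by rw [TensorProduct.add_tmul, add_smul])
      (fun c a b => by rw [← TensorProduct.smul_tmul', smul_assoc])
      (fun a b b' => by rw [unop_add, map_add, smul_add])
      (fun c a b => by rw [unop_smul, map_smul, smul_comm]))
  have h_tmul (a b : A) :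
      h (a ⊗ₜ op b) = (a ⊗ₜ 1 : Env K A) • D b := rfl
  have hh (z : Env K A) (i : Fin n) :
      h (z * envDelta K (g i)) = -(z • dx i) := by
    induction z using env_induction with
    | h0 =>
      rw [zero_mul, map_zero]
      exact (neg_eq_zero.2 (zero_smul (Env K A) (dx i))).symm
    | hadd z z' hz hz' => rw [add_mul, map_add, hz, hz', add_smul, neg_add]
    | htmul a b =>
      rw [envDelta, mul_sub, Algebra.TensorProduct.tmul_mul_tmul,
        Algebra.TensorProduct.tmul_mul_tmul, mul_one, mul_one, ← op_mul, map_sub, h_tmul, h_tmul,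
        hD, smul_add, smul_smul, smul_smul, Algebra.TensorProduct.tmul_mul_tmul,
        Algebra.TensorProduct.tmul_mul_tmul, mul_one, mul_one, one_mul, sub_add_cancel_left]
  have key := congrArg h ht
  rw [map_sum, map_zero] at key
  simp only [hh, Finset.sum_neg_distrib, neg_eq_zero] at key
  exact key

variable (g Q s)

/-- The map `Aᵉ → (Aᵉ)ⁿ` of the bimodule resolution of `A`. -/
def relMap : Env K A →ₗ[Env K A]
    (Fin n → Env K A) :=
  LinearMap.pi fun j => LinearMap.toSpanSingleton _ _ (relDeriv g Q s j)

variable (K) in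
/-- The map `(Aᵉ)ⁿ → Uᵉ` of the bimodule resolution of `A`. -/
def genMap : (Fin n → Env K A) →ₗ[Env K A]
    Env K A :=
  Fintype.linearCombination _ (fun i => envDelta K (g i))

variable {g Q s}

theorem relMap_apply (t : Env K A) (j : Fin n) :
    relMap g Q s t j = t * relDeriv g Q s j := rfl

theorem genMap_apply (t : Fin n → Env K A) :
    genMap K g t = ∑ i, t i * envDelta K (g i) := rfl

/-- The resolution is exact in the middle. -/
theorem IsRegularPresentation.exists_relMap_eq (H : IsRegularPresentation g Q s κ) {t : Fin n → Env K A}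
    (ht : ∑ i, t i * envDelta K (g i) = 0) :
    ∃ u, ∀ j, u * relDeriv g Q s j = t j := by
  let N := LinearMap.range (relMap g Q s)
  -- The universal choice of M: the cokernel of `relMap`, in which ∑ t_i dx_i is the class of t.
  let dx : Fin n → (Fin n → Env K A) ⧸ N := fun i => N.mkQ (Pi.single i 1)
  have sum_dx (t : Fin n → Env K A) : ∑ i, t i • dx i = N.mkQ t := by
    simp only [dx, ← map_smul, ← map_sum]
    congr 1
    ext j
    simp [Pi.single_apply]
  have hdx : ∑ j, relDeriv g Q s j • dx j = 0 := by
    rw [sum_dx, Submodule.mkQ_apply, Submodule.Quotient.mk_eq_zero]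
    exact ⟨1, funext fun j => one_mul _⟩
  have key := H.sum_smul_eq_zero dx hdx ht
  rw [sum_dx, Submodule.mkQ_apply, Submodule.Quotient.mk_eq_zero] at key
  obtain ⟨u, hu⟩ := key
  exact ⟨u, fun j => congrFun hu j⟩

end MiddleExactness

/-! ### Self-duality: exactness of the dual complex -/

section DualExactness

variable {K : Type u} [Field K] {A : Type v} [Ring A] [Algebra K A] {n : ℕ}
  {g : Fin n → A} {Q : Matrix (Fin n) (Fin n) K} {s : Fin n → K} {κ : K} {ξ : A ≃ₐ[K] A}

theorem linearCombination_envDelta (c : Fin n → K) :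
    Fintype.linearCombination K (fun i => envDelta K (g i)) c =
      envDelta K (Fintype.linearCombination K g c) := by
  let D : A →ₗ[K] Env K A := (TensorProduct.mk K A Aᵐᵒᵖ).flip 1 -
    TensorProduct.mk K A Aᵐᵒᵖ 1 ∘ₗ (opLinearEquiv K).toLinearMap
  have hD (a : A) : envDelta K a = D a := rfl
  simp only [hD, Fintype.linearCombination_apply, map_sum, map_smul]

theorem twistFlip_envDelta (a : A) :
    twistFlip K A ξ (envDelta K a) = 1 ⊗ₜ op (ξ a) - a ⊗ₜ 1 := by
  rw [envDelta, map_sub, ← op_one, twistFlip_tmul, twistFlip_tmul, map_one, op_one]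

theorem linearCombination_twistFlip_envDelta
    (hξ : ∀ j, ξ (Fintype.linearCombination K g (Q.col j)) =
      algebraMap K A (s j) - Fintype.linearCombination K g (Q.row j)) (j : Fin n) :
    Fintype.linearCombination K (fun i => twistFlip K A ξ (envDelta K (g i))) (Q.col j) =
      -relDeriv g Q s j := by
  have h : Fintype.linearCombination K (fun i => twistFlip K A ξ (envDelta K (g i))) (Q.col j) =
      twistFlip K A ξ (Fintype.linearCombination K (fun i => envDelta K (g i)) (Q.col j)) := by
    simp only [Fintype.linearCombination_apply, map_sum, map_smul]
  rw [h, linearCombination_envDelta, twistFlip_envDelta, hξ, relDeriv, op_sub, op_sub,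
    TensorProduct.tmul_sub, TensorProduct.tmul_sub]
  abel

theorem twistFlip_relDeriv (hξ : ∀ j, ξ (Fintype.linearCombination K g (Q.col j)) =
      algebraMap K A (s j) - Fintype.linearCombination K g (Q.row j)) (j : Fin n) :
    twistFlip K A ξ (relDeriv g Q s j) =
      Fintype.linearCombination K (fun i => envDelta K (g i)) (Q.row j) := by
  rw [linearCombination_envDelta, envDelta, relDeriv, ← op_one, map_add, twistFlip_tmul,
    twistFlip_tmul, hξ, map_one, op_one,
    op_sub, TensorProduct.tmul_sub, TensorProduct.sub_tmul, Algebra.algebraMap_eq_smul_one,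
    op_smul, op_one, TensorProduct.tmul_smul, TensorProduct.smul_tmul']
  abel

theorem envMul_twistFlip_relDeriv_mul
    (hξ : ∀ j, ξ (Fintype.linearCombination K g (Q.col j)) =
      algebraMap K A (s j) - Fintype.linearCombination K g (Q.row j)) (j : Fin n) (t : Env K A) :
    envMul K A (twistFlip K A ξ (relDeriv g Q s j * t)) = 0 := by
  rw [twistFlip_mul, twistFlip_relDeriv hξ, linearCombination_envDelta, envMul_mul_envDelta]

namespace IsRegularPresentation

theorem eq_zero_of_envDelta_mul (H : IsRegularPresentation g Q s κ)
    (hξ : ∀ j, ξ (Fintype.linearCombination K g (Q.col j)) =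
      algebraMap K A (s j) - Fintype.linearCombination K g (Q.row j))
    {t : Env K A} (ht : ∀ i, envDelta K (g i) * t = 0) : t = 0 := by
  refine (twistFlip K A ξ).injective ((H.eq_zero _ fun j => ?_).trans (map_zero _).symm)
  rw [← neg_neg (relDeriv g Q s j), ← linearCombination_twistFlip_envDelta hξ,
    Fintype.linearCombination_apply, mul_neg, Finset.mul_sum, neg_eq_zero]
  refine Finset.sum_eq_zero fun i _ => ?_
  rw [mul_smul_comm, ← twistFlip_mul, ht, map_zero, smul_zero]

/-- Flipping gives a relation among the δ_i whose coefficients are the Q-combinations of the flipped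
t_i. Middle exactness makes them u r_j; inverting Q and flipping back yields the witness, with a
sign because the flip produces -r_j. -/
theorem exists_envDelta_mul_eq (H : IsRegularPresentation g Q s κ) (hQ : IsUnit Q)
    (hξ : ∀ j, ξ (Fintype.linearCombination K g (Q.col j)) =
      algebraMap K A (s j) - Fintype.linearCombination K g (Q.row j))
    {t : Fin n → Env K A} (ht : ∑ j, relDeriv g Q s j * t j = 0) :
    ∃ u, ∀ i, envDelta K (g i) * u = t i := by
  have h := congrArg (twistFlip K A ξ) ht
  simp only [map_sum, map_zero, twistFlip_mul, twistFlip_relDeriv hξ] at h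
  have h' := sum_linearCombination_mul Q (fun i => twistFlip K A ξ (t i))
    (fun i => envDelta K (g i))
  rw [h] at h'
  obtain ⟨u, hu⟩ := H.exists_relMap_eq h'
  refine ⟨(twistFlip K A ξ).symm (-u), fun i => (twistFlip K A ξ).injective ?_⟩
  refine congrFun (linearCombination_col_ext hQ
    (a := fun i => twistFlip K A ξ (envDelta K (g i) * (twistFlip K A ξ).symm (-u)))
    (b := fun i => twistFlip K A ξ (t i)) fun j => ?_) i
  rw [← hu j, ← neg_neg (relDeriv g Q s j), ← linearCombination_twistFlip_envDelta hξ]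
  simp only [twistFlip_mul, LinearEquiv.apply_symm_apply, Fintype.linearCombination_apply,
    mul_neg, Finset.mul_sum, mul_smul_comm]
  rw [← Finset.sum_neg_distrib]
  exact Finset.sum_congr rfl fun i _ =>
    (congrArg _ (neg_mul u _)).trans (smul_neg (Q.col j i) _)

/-- The flipped r_j are Qᵗ-combinations of the δ_i, so they generate the kernel of multiplication as
well. -/
theorem exists_sum_relDeriv_mul_eq (H : IsRegularPresentation g Q s κ) (hQ : IsUnit Q)
    (hξ : ∀ j, ξ (Fintype.linearCombination K g (Q.col j)) =
      algebraMap K A (s j) - Fintype.linearCombination K g (Q.row j))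
    {t : Env K A} (ht : envMul K A (twistFlip K A ξ t) = 0) :
    ∃ u : Fin n → Env K A, ∑ j, relDeriv g Q s j * u j = t := by
  obtain ⟨u, hu⟩ := mem_span_envDelta H.adjoin_eq_top ht
  have hQ' : IsUnit Q.transpose := (Matrix.isUnit_transpose Q).2 hQ
  have h (i : Fin n) : envDelta K (g i) =
      ∑ j, Q.transpose⁻¹ j i • twistFlip K A ξ (relDeriv g Q s j) := by
    simp only [twistFlip_relDeriv hξ]
    exact eq_sum_inv_smul_linearCombination hQ' (fun i => envDelta K (g i)) i
  refine ⟨fun j => (twistFlip K A ξ).symm (∑ i, Q.transpose⁻¹ j i • u i),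
    (twistFlip K A ξ).injective ?_⟩
  simp only [map_sum, twistFlip_mul, LinearEquiv.apply_symm_apply]
  rw [← hu]
  simp only [h, Finset.mul_sum, Finset.sum_mul, mul_smul_comm, smul_mul_assoc]
  rw [Finset.sum_comm]

end IsRegularPresentation

end DualExactness

/-! ### Ext from a projective resolution of length two, by dimension shifting -/

section ExtOfResolution

open CategoryTheory CategoryTheory.Abelian

variable {R : Type v} [Ring R] {P₀ P₁ P₂ N Y : Type v} [AddCommGroup P₀] [Module R P₀]
  [AddCommGroup P₁] [Module R P₁] [AddCommGroup P₂] [Module R P₂]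
  [AddCommGroup N] [Module R N] [AddCommGroup Y] [Module R Y]
  {d₂ : P₂ →ₗ[R] P₁} {d₁ : P₁ →ₗ[R] P₀} {ε : P₀ →ₗ[R] N}

/-- The short exact sequence `0 → ker ε → P₀ → N → 0`. -/
abbrev augSeq (ε : P₀ →ₗ[R] N) : ShortComplex (ModuleCat.{v} R) :=
  ShortComplex.mk (ModuleCat.ofHom (LinearMap.ker ε).subtype) (ModuleCat.ofHom ε)
    (by ext t; exact t.2)

theorem augSeq_shortExact (hε : Function.Surjective ε) : (augSeq ε).ShortExact :=
  ModuleCat.shortComplex_shortExact _ (fun t => ⟨fun ht => ⟨⟨t, ht⟩, rfl⟩, by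
    rintro ⟨t, rfl⟩; exact t.2⟩) Subtype.val_injective hε

/-- The short exact sequence `0 → P₂ → P₁ → ker ε → 0`. -/
abbrev syzSeq (h₁ : Function.Exact d₁ ε) (h₂ : Function.Exact d₂ d₁) :
    ShortComplex (ModuleCat.{v} R) :=
  ShortComplex.mk (ModuleCat.ofHom d₂)
    (ModuleCat.ofHom (d₁.codRestrict (LinearMap.ker ε) fun t => h₁.apply_apply_eq_zero t))
    (ModuleCat.hom_ext (LinearMap.ext fun t => Subtype.ext (h₂.apply_apply_eq_zero t)))

theorem syzSeq_shortExact (h₁ : Function.Exact d₁ ε) (h₂ : Function.Exact d₂ d₁)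
    (h₃ : Function.Injective d₂) : (syzSeq h₁ h₂).ShortExact :=
  ModuleCat.shortComplex_shortExact _ (fun t => Subtype.ext_iff.trans (h₂ t)) h₃ (fun t => by
      obtain ⟨p, hp⟩ := (h₁ t.1).1 t.2
      exact ⟨p, Subtype.ext hp⟩)

theorem subsingleton_ext_zero (hε : Function.Surjective ε) (h₁ : Function.Exact d₁ ε)
    (h : ∀ φ : P₀ →ₗ[R] Y, φ ∘ₗ d₁ = 0 → φ = 0) :
    Subsingleton (Ext (ModuleCat.of R N) (ModuleCat.of R Y) 0) := by
  refine subsingleton_of_forall_eq 0 fun e => ?_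
  obtain ⟨φ, rfl⟩ := (Ext.mk₀_bijective _ _).2 e
  have h0 : φ.hom ∘ₗ ε = 0 := h _ (by
    rw [LinearMap.comp_assoc, h₁.linearMap_comp_eq_zero, LinearMap.comp_zero])
  have : φ = 0 := by
    ext t
    obtain ⟨p, rfl⟩ := hε t
    exact LinearMap.congr_fun h0 p
  rw [this, Ext.mk₀_zero]

theorem subsingleton_ext_one [Module.Projective R P₀]
    (hε : Function.Surjective ε) (h₁ : Function.Exact d₁ ε)
    (h₂ : Function.Exact d₂ d₁)
    (h : ∀ φ : P₁ →ₗ[R] Y, φ ∘ₗ d₂ = 0 → ∃ ψ : P₀ →ₗ[R] Y, ψ ∘ₗ d₁ = φ) :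
    Subsingleton (Ext (ModuleCat.of R N) (ModuleCat.of R Y) 1) := by
  refine subsingleton_of_forall_eq 0 fun e => ?_
  obtain ⟨e₁, rfl⟩ := Ext.contravariant_sequence_exact₃ (augSeq_shortExact hε) (ModuleCat.of R Y) e
    (Ext.eq_zero_of_projective _) (add_zero 1)
  obtain ⟨φ, rfl⟩ := (Ext.mk₀_bijective _ _).2 e₁
  let d : P₁ →ₗ[R] LinearMap.ker ε := d₁.codRestrict _ fun t => h₁.apply_apply_eq_zero t
  obtain ⟨ψ, hψ⟩ := h (φ.hom ∘ₗ d) (by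
    rw [LinearMap.comp_assoc]
    have : d ∘ₗ d₂ = 0 := by
      ext t
      exact h₂.apply_apply_eq_zero t
    rw [this, LinearMap.comp_zero])
  have : φ = (augSeq ε).f ≫ ModuleCat.ofHom ψ := by
    ext t
    obtain ⟨p, hp⟩ := (h₁ t.1).1 t.2
    obtain rfl : d p = t := Subtype.ext hp
    exact (LinearMap.congr_fun hψ p).symm
  rw [this, ← Ext.mk₀_comp_mk₀]
  exact (augSeq_shortExact hε).extClass_comp_assoc _ (h := add_zero 1)

theorem subsingleton_ext_add_three [Module.Projective R P₀] [Module.Projective R P₁] [Module.Projective R P₂]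
    (hε : Function.Surjective ε) (h₁ : Function.Exact d₁ ε)
    (h₂ : Function.Exact d₂ d₁) (h₃ : Function.Injective d₂) (i : ℕ) :
    Subsingleton (Ext (ModuleCat.of R N) (ModuleCat.of R Y) (i + 3)) := by
  refine subsingleton_of_forall_eq 0 fun e => ?_
  obtain ⟨e₁, rfl⟩ := Ext.contravariant_sequence_exact₃ (augSeq_shortExact hε) (ModuleCat.of R Y) e
    (Ext.eq_zero_of_projective _) (n₀ := i + 2) (by omega)
  obtain ⟨e₂, rfl⟩ := Ext.contravariant_sequence_exact₃ (syzSeq_shortExact h₁ h₂ h₃)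
    (ModuleCat.of R Y) e₁ (Ext.eq_zero_of_projective _) (n₀ := i + 1) (by omega)
  rw [show e₂ = 0 from Ext.eq_zero_of_projective _, Ext.comp_zero, Ext.comp_zero]

/-- The connecting map `Hom(P₂, Y) → Ext²(N, Y)` of a projective resolution of length two. -/
def extTwoMk (hε : Function.Surjective ε) (h₁ : Function.Exact d₁ ε)
    (h₂ : Function.Exact d₂ d₁) (h₃ : Function.Injective d₂) (φ : P₂ →ₗ[R] Y) :
    Ext (ModuleCat.of R N) (ModuleCat.of R Y) 2 :=
  (augSeq_shortExact hε).extClass.comp ((syzSeq_shortExact h₁ h₂ h₃).extClass.comp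
    (Ext.mk₀ (ModuleCat.ofHom φ)) (add_zero 1)) (by norm_num)

variable (hε : Function.Surjective ε) (h₁ : Function.Exact d₁ ε)
    (h₂ : Function.Exact d₂ d₁) (h₃ : Function.Injective d₂)

theorem extTwoMk_add (φ ψ : P₂ →ₗ[R] Y) : extTwoMk hε h₁ h₂ h₃ (φ + ψ) =
    extTwoMk hε h₁ h₂ h₃ φ + extTwoMk hε h₁ h₂ h₃ ψ := by
  rw [extTwoMk, ModuleCat.ofHom_add, Ext.mk₀_add, Ext.comp_add, Ext.comp_add]
  rfl

theorem extTwoMk_comp (φ : P₂ →ₗ[R] Y) (f : Y →ₗ[R] Y) : extTwoMk hε h₁ h₂ h₃ (f ∘ₗ φ) =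
    (extTwoMk hε h₁ h₂ h₃ φ).comp (Ext.mk₀ (ModuleCat.ofHom f)) (add_zero 2) := by
  rw [extTwoMk, extTwoMk, ModuleCat.ofHom_comp, ← Ext.mk₀_comp_mk₀,
    Ext.comp_assoc_of_third_deg_zero, Ext.comp_assoc_of_third_deg_zero]

theorem extTwoMk_surjective [Module.Projective R P₀] [Module.Projective R P₁] :
    Function.Surjective (extTwoMk (Y := Y) hε h₁ h₂ h₃) := by
  intro e
  obtain ⟨e₁, rfl⟩ := Ext.contravariant_sequence_exact₃ (augSeq_shortExact hε) (ModuleCat.of R Y) e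
    (Ext.eq_zero_of_projective _) (n₀ := 1) (by omega)
  obtain ⟨e₂, rfl⟩ := Ext.contravariant_sequence_exact₃ (syzSeq_shortExact h₁ h₂ h₃)
    (ModuleCat.of R Y) e₁ (Ext.eq_zero_of_projective _) (n₀ := 0) (by omega)
  obtain ⟨φ, rfl⟩ := (Ext.mk₀_bijective _ _).2 e₂
  exact ⟨φ.hom, rfl⟩

/-- Composition with the first extension class is injective on Ext¹ because Ext¹(P₀, Y) = 0; the
second connecting map kills exactly the maps that extend along d₂. -/
theorem extTwoMk_eq_zero_iff [Module.Projective R P₀]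
    (φ : P₂ →ₗ[R] Y) :
    extTwoMk hε h₁ h₂ h₃ φ = 0 ↔ ∃ ψ : P₁ →ₗ[R] Y, ψ ∘ₗ d₂ = φ := by
  constructor
  · intro h
    obtain ⟨e₁, he₁⟩ := Ext.contravariant_sequence_exact₁ (augSeq_shortExact hε)
      (ModuleCat.of R Y) _ _ h
    rw [show e₁ = 0 from Ext.eq_zero_of_projective _, Ext.comp_zero] at he₁
    obtain ⟨e₂, he₂⟩ := Ext.contravariant_sequence_exact₁ (syzSeq_shortExact h₁ h₂ h₃)
      (ModuleCat.of R Y) _ _ he₁.symm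
    obtain ⟨ψ, rfl⟩ := (Ext.mk₀_bijective _ _).2 e₂
    rw [Ext.mk₀_comp_mk₀] at he₂
    refine ⟨ψ.hom, ?_⟩
    exact congrArg ModuleCat.Hom.hom ((Ext.mk₀_bijective _ _).1 he₂)
  · rintro ⟨ψ, rfl⟩
    rw [extTwoMk, ModuleCat.ofHom_comp, ← Ext.mk₀_comp_mk₀]
    have := (syzSeq_shortExact h₁ h₂ h₃).extClass_comp_assoc (Ext.mk₀ (ModuleCat.ofHom ψ))
      (h := add_zero 1)
    rw [this, Ext.comp_zero]

end ExtOfResolution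

/-- The action on T is a bare function ρ: in the application T = A ⊗ A already carries the outer
module structure, while the relevant action is the inner one. -/
theorem nonempty_linearEquiv_of_ker_eq {R T M N : Type*} [Ring R] [AddCommGroup T]
    [AddCommGroup M] [Module R M] [AddCommGroup N] [Module R N] (f : T →+ M) (g : T →+ N)
    (hf : Function.Surjective f) (hg : Function.Surjective g) (hk : ∀ t, f t = 0 ↔ g t = 0)
    (ρ : R → T → T) (hρf : ∀ z t, f (ρ z t) = z • f t) (hρg : ∀ z t, g (ρ z t) = z • g t) :
    Nonempty (M ≃ₗ[R] N) := by
  have key (t t' : T) : f t = f t' ↔ g t = g t' := by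
    rw [← sub_eq_zero, ← map_sub, hk, map_sub, sub_eq_zero]
  have hs (t : T) : g (Function.surjInv hf (f t)) = g t :=
    (key _ _).1 (Function.surjInv_eq hf _)
  refine ⟨LinearEquiv.ofBijective
    { toFun := fun m => g (Function.surjInv hf m)
      map_add' := fun m m' => ?_
      map_smul' := fun z m => ?_ } ⟨fun m m' h => ?_, fun k => ?_⟩⟩
  · obtain ⟨t, rfl⟩ := hf m
    obtain ⟨t', rfl⟩ := hf m'
    rw [← map_add, hs, hs, hs, map_add]
  · obtain ⟨t, rfl⟩ := hf m
    rw [← hρf, hs, hs, hρg, RingHom.id_apply]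
  · obtain ⟨t, rfl⟩ := hf m
    obtain ⟨t', rfl⟩ := hf m'
    have h : g (Function.surjInv hf (f t)) = g (Function.surjInv hf (f t')) := h
    rw [hs, hs] at h
    exact (key _ _).2 h
  · obtain ⟨t, rfl⟩ := hg k
    exact ⟨f t, hs t⟩

/-! ### The bimodule resolution and the computation of Ext -/

section Resolution

variable {K : Type u} [Field K] {A : Type v} [Ring A] [Algebra K A] {n : ℕ}

variable (K A) in
/-- The augmentation `Aᵉ → A` of the bimodule resolution. -/
def augMap : Env K A →ₗ[Env K A] Regular K A :=
  LinearMap.toSpanSingleton (Env K A) (Regular K A) (show Regular K A from (1 : A))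

theorem augMap_eq_zero_iff (t : Env K A) : augMap K A t = 0 ↔ envMul K A t = 0 := Iff.rfl

variable (K A) in
theorem augMap_surjective : Function.Surjective (augMap K A) := fun (a : A) =>
  ⟨a ⊗ₜ op 1, (envMul_tmul a 1).trans (mul_one a)⟩

variable (K A) in
/-- `A ⊗ A` with its outer structure is free of rank one over `Aᵉ`. -/
def envEquivSquare : Env K A ≃ₗ[Env K A] TensorSquare K A where
  __ := (TensorProduct.congr (LinearEquiv.refl K A) (opLinearEquiv K).symm :
    A ⊗[K] Aᵐᵒᵖ ≃ₗ[K] A ⊗[K] A)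
  map_smul' z t := by
    change TensorProduct.congr (LinearEquiv.refl K A) (opLinearEquiv K).symm (z * t) =
      outer K A z (TensorProduct.congr (LinearEquiv.refl K A) (opLinearEquiv K).symm t)
    induction z using env_induction with
    | h0 => simp
    | hadd z z' hz hz' => simp only [add_mul, map_add, hz, hz', LinearMap.add_apply]
    | htmul a b =>
      induction t using env_induction with
      | h0 => simp
      | hadd t t' ht ht' => simp only [mul_add, map_add, ht, ht']
      | htmul c d =>
        rw [Algebra.TensorProduct.tmul_mul_tmul]
        rfl

/-- The map `x ⊗ y ↦ y ξ(x)` from `A ⊗ A` to `₁A_ξ`. -/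
def squareToTwisted (ξ : A ≃ₐ[K] A) : TensorSquare K A →+ Twisted ξ :=
  (show A ⊗[K] A →+ A from LinearMap.toAddMonoidHom
    (envMul K A ∘ₗ (twistFlip K A ξ).toLinearMap ∘ₗ
      (TensorProduct.congr (LinearEquiv.refl K A) (opLinearEquiv K)).toLinearMap))

theorem squareToTwisted_envEquivSquare (ξ : A ≃ₐ[K] A) (t : Env K A) :
    squareToTwisted ξ (envEquivSquare K A t) = envMul K A (twistFlip K A ξ t) := by
  induction t using env_induction with
  | h0 => rw [map_zero, map_zero, map_zero, map_zero]; rfl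
  | hadd t t' ht ht' => rw [map_add, map_add, ht, ht', map_add, map_add]; rfl
  | htmul a b => rfl

theorem squareToTwisted_innerEnd (ξ : A ≃ₐ[K] A) (z : Env K A) (t : TensorSquare K A) :
    squareToTwisted ξ (innerEnd K A z t) = z • squareToTwisted ξ t := by
  obtain ⟨t, rfl⟩ := (envEquivSquare K A).surjective t
  induction z using env_induction with
  | h0 =>
    rw [map_zero, LinearMap.zero_apply, map_zero]
    exact (zero_smul (Env K A) (squareToTwisted ξ (envEquivSquare K A t))).symm
  | hadd z z' hz hz' => rw [map_add, add_smul, LinearMap.add_apply, map_add, hz, hz']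
  | htmul a b =>
    induction t using env_induction with
    | h0 => rw [map_zero, map_zero, map_zero, smul_zero]
    | hadd t t' ht ht' => simp only [map_add, smul_add, ht, ht']
    | htmul c d =>
      have h1 : innerEnd K A (a ⊗ₜ op b) (envEquivSquare K A (c ⊗ₜ op d)) =
          envEquivSquare K A ((c * b) ⊗ₜ op (a * d)) := rfl
      rw [h1, squareToTwisted_envEquivSquare, squareToTwisted_envEquivSquare, twistFlip_tmul,
        twistFlip_tmul, envMul_tmul, envMul_tmul]
      refine Eq.trans ?_ (twisted_smul ξ a b (d * ξ c)).symm
      change a * d * ξ (c * b) = a * (d * ξ c) * ξ b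
      simp only [map_mul, mul_assoc]

theorem squareToTwisted_surjective (ξ : A ≃ₐ[K] A) : Function.Surjective (squareToTwisted ξ) :=
  fun (a : A) => ⟨envEquivSquare K A (1 ⊗ₜ op a), by
    rw [squareToTwisted_envEquivSquare, twistFlip_tmul, envMul_tmul, map_one, mul_one]⟩

namespace IsRegularPresentation

variable {g : Fin n → A} {Q : Matrix (Fin n) (Fin n) K} {s : Fin n → K} {κ : K} {ξ : A ≃ₐ[K] A}

theorem exact_genMap_augMap (H : IsRegularPresentation g Q s κ) :
    Function.Exact (genMap K g) (augMap K A) := fun t =>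
  ⟨fun ht => mem_span_envDelta H.adjoin_eq_top ht, by
    rintro ⟨u, rfl⟩
    rw [augMap_eq_zero_iff, genMap_apply, map_sum]
    exact Finset.sum_eq_zero fun i _ => envMul_mul_envDelta _ _⟩

theorem exact_relMap_genMap (H : IsRegularPresentation g Q s κ) :
    Function.Exact (relMap g Q s) (genMap K g) := fun t =>
  ⟨fun ht => by
    obtain ⟨u, hu⟩ := H.exists_relMap_eq ht
    exact ⟨u, funext hu⟩, by
    rintro ⟨u, rfl⟩
    rw [genMap_apply]
    simp only [relMap_apply, mul_assoc, ← Finset.mul_sum]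
    rw [H.sum_relDeriv_mul_envDelta, mul_zero]⟩

theorem relMap_injective (H : IsRegularPresentation g Q s κ) :
    Function.Injective (relMap g Q s) :=
  (injective_iff_map_eq_zero _).2 fun _ ht => H.eq_zero _ fun j => congrFun ht j

theorem genMap_single (i : Fin n) : genMap K g (Pi.single i 1) = envDelta K (g i) := by
  rw [genMap, Fintype.linearCombination_apply_single, one_smul]

theorem apply_eq_sum_single {R M : Type*} [Ring R] [AddCommGroup M] [Module R M]
    (φ : (Fin n → R) →ₗ[R] M) (t : Fin n → R) : φ t = ∑ i, t i • φ (Pi.single i 1) := by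
  conv_lhs => rw [← Finset.univ_sum_single t, map_sum]
  refine Finset.sum_congr rfl fun i _ => ?_
  rw [← map_smul, ← Pi.single_smul, smul_eq_mul, mul_one]

/-- As A ⊗ A is free of rank one, φ is right multiplication by some e in Aᵉ, and the hypothesis says
δ_i e = 0 for all i. -/
theorem eq_zero_of_comp_genMap (H : IsRegularPresentation g Q s κ)
    (hξ : ∀ j, ξ (Fintype.linearCombination K g (Q.col j)) =
      algebraMap K A (s j) - Fintype.linearCombination K g (Q.row j))
    {φ : Env K A →ₗ[Env K A] TensorSquare K A} (hφ : φ ∘ₗ genMap K g = 0) : φ = 0 := by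
  obtain ⟨e, he⟩ := (envEquivSquare K A).surjective (φ 1)
  have h0 : e = 0 := H.eq_zero_of_envDelta_mul hξ fun i => by
    refine (envEquivSquare K A).injective ?_
    rw [← smul_eq_mul, map_smul, he, map_zero, ← map_smul, smul_eq_mul, mul_one,
      ← genMap_single]
    exact LinearMap.congr_fun hφ _
  refine LinearMap.ext_ring ?_
  rw [← he, h0, map_zero]
  rfl

theorem relMap_one : relMap g Q s 1 = relDeriv g Q s := funext fun _ => one_mul _

theorem exists_comp_genMap_eq (H : IsRegularPresentation g Q s κ) (hQ : IsUnit Q)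
    (hξ : ∀ j, ξ (Fintype.linearCombination K g (Q.col j)) =
      algebraMap K A (s j) - Fintype.linearCombination K g (Q.row j))
    {φ : (Fin n → Env K A) →ₗ[Env K A] TensorSquare K A} (hφ : φ ∘ₗ relMap g Q s = 0) :
    ∃ ψ : Env K A →ₗ[Env K A] TensorSquare K A, ψ ∘ₗ genMap K g = φ := by
  have hsum : ∑ j, relDeriv g Q s j * (envEquivSquare K A).symm (φ (Pi.single j 1)) = 0 := by
    refine (envEquivSquare K A).injective ?_
    simp only [map_sum, ← smul_eq_mul, map_smul, LinearEquiv.apply_symm_apply, map_zero]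
    rw [← apply_eq_sum_single φ (relDeriv g Q s), ← relMap_one]
    exact LinearMap.congr_fun hφ 1
  obtain ⟨u, hu⟩ := H.exists_envDelta_mul_eq hQ hξ hsum
  refine ⟨LinearMap.toSpanSingleton _ _ (envEquivSquare K A u), LinearMap.ext fun t => ?_⟩
  rw [apply_eq_sum_single φ, LinearMap.comp_apply, LinearMap.toSpanSingleton_apply,
    genMap_apply, Finset.sum_smul]
  refine Finset.sum_congr rfl fun i _ => ?_
  rw [mul_smul, ← map_smul, smul_eq_mul, hu, LinearEquiv.apply_symm_apply]

theorem subsingleton_extTensorSquare_zero (H : IsRegularPresentation g Q s κ)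
    (hξ : ∀ j, ξ (Fintype.linearCombination K g (Q.col j)) =
      algebraMap K A (s j) - Fintype.linearCombination K g (Q.row j)) :
    Subsingleton (ExtTensorSquare K A 0) :=
  subsingleton_ext_zero (augMap_surjective K A) H.exact_genMap_augMap
    fun _ hφ => H.eq_zero_of_comp_genMap hξ hφ

theorem subsingleton_extTensorSquare_one (H : IsRegularPresentation g Q s κ) (hQ : IsUnit Q)
    (hξ : ∀ j, ξ (Fintype.linearCombination K g (Q.col j)) =
      algebraMap K A (s j) - Fintype.linearCombination K g (Q.row j)) :
    Subsingleton (ExtTensorSquare K A 1) :=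
  subsingleton_ext_one (augMap_surjective K A) H.exact_genMap_augMap H.exact_relMap_genMap
    fun _ hφ => H.exists_comp_genMap_eq hQ hξ hφ

theorem subsingleton_extTensorSquare_add_three (H : IsRegularPresentation g Q s κ) (i : ℕ) :
    Subsingleton (ExtTensorSquare K A (i + 3)) :=
  subsingleton_ext_add_three (augMap_surjective K A) H.exact_genMap_augMap
    H.exact_relMap_genMap H.relMap_injective i

/-- `Extⁱ(A, A ⊗ A)` vanishes for `i ≠ 2`. -/
theorem subsingleton_extTensorSquare (H : IsRegularPresentation g Q s κ) (hQ : IsUnit Q)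
    (hξ : ∀ j, ξ (Fintype.linearCombination K g (Q.col j)) =
      algebraMap K A (s j) - Fintype.linearCombination K g (Q.row j)) :
    ∀ i : ℕ, i ≠ 2 → Subsingleton (ExtTensorSquare K A i)
  | 0, _ => H.subsingleton_extTensorSquare_zero hξ
  | 1, _ => H.subsingleton_extTensorSquare_one hQ hξ
  | i + 3, _ => H.subsingleton_extTensorSquare_add_three i

/-- The map `A ⊗ A → Ext²(A, A ⊗ A)` given by the last term of the resolution. -/
def squareToExt (H : IsRegularPresentation g Q s κ) :
    TensorSquare K A →+ ExtTensorSquare K A 2 where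
  toFun t := extTwoMk (augMap_surjective K A) H.exact_genMap_augMap H.exact_relMap_genMap
    H.relMap_injective (LinearMap.toSpanSingleton (Env K A) (TensorSquare K A) t)
  map_zero' := by
    refine (extTwoMk_eq_zero_iff _ _ _ _ _).2 ⟨0, ?_⟩
    rw [LinearMap.zero_comp, LinearMap.toSpanSingleton_zero]
  map_add' t t' := by
    rw [LinearMap.toSpanSingleton_add]
    exact extTwoMk_add _ _ _ _ _ _

theorem squareToExt_apply (H : IsRegularPresentation g Q s κ) (t : TensorSquare K A) :
    H.squareToExt t = extTwoMk (augMap_surjective K A) H.exact_genMap_augMap H.exact_relMap_genMap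
      H.relMap_injective (LinearMap.toSpanSingleton (Env K A) (TensorSquare K A) t) := rfl

theorem squareToExt_innerEnd (H : IsRegularPresentation g Q s κ) (z : Env K A)
    (t : TensorSquare K A) : H.squareToExt (innerEnd K A z t) = z • H.squareToExt t := by
  have h : LinearMap.toSpanSingleton (Env K A) (TensorSquare K A) (innerEnd K A z t) =
      innerEnd K A z ∘ₗ LinearMap.toSpanSingleton (Env K A) (TensorSquare K A) t := by
    refine LinearMap.ext_ring ?_
    rw [LinearMap.comp_apply, LinearMap.toSpanSingleton_apply, LinearMap.toSpanSingleton_apply,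
      one_smul, one_smul]
  have h2 := extTwoMk_comp (augMap_surjective K A) H.exact_genMap_augMap H.exact_relMap_genMap
    H.relMap_injective (LinearMap.toSpanSingleton (Env K A) (TensorSquare K A) t)
    (innerEnd K A z)
  rw [← h] at h2
  exact h2

theorem squareToExt_surjective (H : IsRegularPresentation g Q s κ) :
    Function.Surjective H.squareToExt := by
  intro e
  obtain ⟨φ, rfl⟩ := extTwoMk_surjective (augMap_surjective K A) H.exact_genMap_augMap
    H.exact_relMap_genMap H.relMap_injective e
  have h : LinearMap.toSpanSingleton (Env K A) (TensorSquare K A) (φ 1) = φ := by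
    refine LinearMap.ext_ring ?_
    rw [LinearMap.toSpanSingleton_apply, one_smul]
  refine ⟨φ 1, ?_⟩
  rw [squareToExt_apply, h]

/-- Both conditions say that t lies in the right ideal ∑ r_j Aᵉ: on the Ext side these are the maps
factoring through `relMap`, on the twisted side this is the kernel of multiplication after the flip.
-/
theorem squareToExt_eq_zero_iff (H : IsRegularPresentation g Q s κ) (hQ : IsUnit Q)
    (hξ : ∀ j, ξ (Fintype.linearCombination K g (Q.col j)) =
      algebraMap K A (s j) - Fintype.linearCombination K g (Q.row j)) (t : TensorSquare K A) :
    H.squareToExt t = 0 ↔ squareToTwisted ξ t = 0 := by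
  obtain ⟨t, rfl⟩ := (envEquivSquare K A).surjective t
  rw [squareToTwisted_envEquivSquare]
  have h0 := extTwoMk_eq_zero_iff (augMap_surjective K A) H.exact_genMap_augMap H.exact_relMap_genMap
    H.relMap_injective (LinearMap.toSpanSingleton (Env K A) (TensorSquare K A)
      (envEquivSquare K A t))
  refine Iff.trans h0 ⟨?_, fun ht => ?_⟩
  · rintro ⟨ψ, hψ⟩
    have h1 := LinearMap.congr_fun hψ 1
    rw [LinearMap.comp_apply, relMap_one, LinearMap.toSpanSingleton_apply, one_smul,
      apply_eq_sum_single ψ] at h1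
    have h3 : t = ∑ j, relDeriv g Q s j * (envEquivSquare K A).symm (ψ (Pi.single j 1)) := by
      refine (envEquivSquare K A).injective ?_
      rw [← h1]
      simp only [map_sum, ← smul_eq_mul, map_smul, LinearEquiv.apply_symm_apply]
    rw [h3, map_sum, map_sum]
    exact Finset.sum_eq_zero fun j _ => envMul_twistFlip_relDeriv_mul hξ j _
  · obtain ⟨u, rfl⟩ := H.exists_sum_relDeriv_mul_eq hQ hξ ht
    refine ⟨Fintype.linearCombination (Env K A) fun j => envEquivSquare K A (u j),
      LinearMap.ext_ring ?_⟩
    rw [LinearMap.comp_apply, Fintype.linearCombination_apply, LinearMap.toSpanSingleton_apply,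
      one_smul, map_sum]
    refine Finset.sum_congr rfl fun j _ => ?_
    rw [relMap_apply, one_mul, ← map_smul, smul_eq_mul]

/-- `Ext²(A, A ⊗ A)` is the twisted bimodule `₁A_ξ`. -/
theorem nonempty_extTensorSquare_two_equiv (H : IsRegularPresentation g Q s κ) (hQ : IsUnit Q)
    (hξ : ∀ j, ξ (Fintype.linearCombination K g (Q.col j)) =
      algebraMap K A (s j) - Fintype.linearCombination K g (Q.row j)) :
    Nonempty (ExtTensorSquare K A 2 ≃ₗ[Env K A] Twisted ξ) :=
  nonempty_linearEquiv_of_ker_eq H.squareToExt (squareToTwisted ξ) H.squareToExt_surjective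
    (squareToTwisted_surjective ξ) (H.squareToExt_eq_zero_iff hQ hξ)
    (fun z t => innerEnd K A z t) H.squareToExt_innerEnd (squareToTwisted_innerEnd ξ)

end IsRegularPresentation

end Resolution

end NakayamaDim2

end

theorem mainTheorem4 {K : Type u} [Field K] [CharZero K] {V : Type v} [AddCommGroup V] [Module K V]
    {n : ℕ} (hn : 2 ≤ n) (x : Module.Basis (Fin n) K V)
    (Q : Matrix (Fin n) (Fin n) K) (hQ : IsUnit Q) (s : Fin n → K) (κ : K) :
    (∀ i : ℕ, i ≠ 2 →
      Subsingleton (NakayamaDim2.ExtTensorSquare K (NakayamaDim2.Deformation x Q s κ) i)) ∧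
    ∃ ξ : NakayamaDim2.Deformation x Q s κ ≃ₐ[K] NakayamaDim2.Deformation x Q s κ,
      (∀ j : Fin n, ξ (NakayamaDim2.gen x Q s κ j) =
        -(∑ i, (Q.transpose * Q⁻¹) i j • NakayamaDim2.gen x Q s κ i) +
          algebraMap K (NakayamaDim2.Deformation x Q s κ) (Matrix.vecMul s Q⁻¹ j)) ∧
      Nonempty (NakayamaDim2.ExtTensorSquare K (NakayamaDim2.Deformation x Q s κ) 2
        ≃ₗ[NakayamaDim2.Env K (NakayamaDim2.Deformation x Q s κ)] NakayamaDim2.Twisted ξ) := by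
  have H := NakayamaDim2.isRegularPresentation_gen (x := x) (s := s) (κ := κ) hn hQ
  have hξ := NakayamaDim2.nakayama_col x s κ hQ
  exact ⟨H.subsingleton_extTensorSquare hQ hξ, NakayamaDim2.nakayama x s κ hQ,
    NakayamaDim2.nakayama_gen x s κ hQ, H.nonempty_extTensorSquare_two_equiv hQ hξ⟩
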